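/- For $M>0$ and $\alpha>1/2$ let $\Sigma=\Sigma_{\alpha,M}$ be the set of real functions $f\in L_2(-\pi,\pi)$ with $f(\omega)=f(-\omega)\ge M^{-1}$ for all $\omega\in[-\pi,\pi]$ and $$\gamma_f(0)^2+\sum_{k\in\mathbb Z}|k|^{2\alpha}\gamma_f(k)^2\le M,\qquad \gamma_f(k)=\int_{-\pi}^{\pi}e^{ik\omega}f(\omega)\,d\omega .$$ For $n\in\mathbb N$ let $\mathcal E_n=(N_n(0,\Gamma_n(f)),\ f\in\Sigma)$, where $\Gamma_n(f)=(\gamma_f(k-j))_{j,k=1}^n$, be the experiment of observing $n$ successive values of a centered stationary Gaussian sequence with spectral density $f$. Let $\mathring{\mathcal E}_n=(N_n(0,\mathrm{Diag}(J_{j,n}(f))_{j=1,\dots,n}),\ f\in\Sigma)$, where $J_{j,n}(f)=n\int_{(j-1)/n}^{j/n}f(2\pi x-\pi)\,dx$, be the Gaussian scale experiment of grid size $n$. For odd $n$ put $r_n=2\lfloor(\log n)/2\rfloor+1$ (so that $r_n\sim\log n$ and $(n-r_n)/2$ is a nonnegative integer) and $$\mathring{\mathcal E}_{l,n}=\mathring{\mathcal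 E}_{(n-r_n)/2}\otimes\mathring{\mathcal E}_{(n-r_n)/2},$$ the experiment of observing two independent copies with the same $f$. Then, as $n\to\infty$ through the odd integers, $\mathring{\mathcal E}_{l,n}$ is asymptotically less informative than $\mathcal E_n$; that is, the deficiency of $\mathcal E_n$ with respect to $\mathring{\mathcal E}_{l,n}$ tends to zero: $$\delta(\mathcal E_n,\mathring{\mathcal E}_{l,n})=\inf_K\ \sup_{f\in\Sigma}\ \bigl\|\mathring P_{l,n,f}-K P_{n,f}\bigr\|_{TV}\longrightarrow 0 ,$$ where $P_{n,f}$ and $\mathring P_{l,n,f}$ are the laws of $\mathcal E_n$ and $\mathring{\mathcal E}_{l,n}$ under $f$, the infimum is over all Markov kernels $K$ from $\mathbb R^n$ to $\mathbb R^{(n-r_n)/2}\times\mathbb R^{(n-r_n)/2}$, and $\|P-Q\|_{TV}=\sup_A|P(A)-Q(A)|$. -/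

import Mathlib

open MeasureTheory ProbabilityTheory Filter Topology Set
open scoped ENNReal Real

noncomputable section

namespace GaussTS

/-! ### Comparison of statistical experiments

An experiment with parameter set `S ⊆ Θ` is a family `P : Θ → Measure X` of laws, of which only
the members `P θ`, `θ ∈ S`, matter. -/

/-- Total variation distance `sup_A |P(A) - Q(A)|` of two finite measures. -/
def tvDist {X : Type*} [MeasurableSpace X] (P Q : Measure X) : ℝ≥0∞ :=
  ⨆ (A : Set X) (_ : MeasurableSet A), ENNReal.ofReal |P.real A - Q.real A|

/-- The deficiency `δ(E, F) = inf_K sup_{θ ∈ S} ‖Q_θ - K P_θ‖_TV` of the experiment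
`E = (P_θ, θ ∈ S)` with respect to `F = (Q_θ, θ ∈ S)`; the infimum is over all Markov kernels
from the sample space of `E` to that of `F`. -/
def deficiency {Θ X Y : Type*} [MeasurableSpace X] [MeasurableSpace Y] (S : Set Θ)
    (P : Θ → Measure X) (Q : Θ → Measure Y) : ℝ≥0∞ :=
  ⨅ (K : Kernel X Y) (_ : IsMarkovKernel K), ⨆ θ ∈ S, tvDist (Q θ) ((P θ).bind K)

/-- `E_n ≾ F_n` along the filter `l`: the experiments `E_n = (P_{n,θ}, θ ∈ S)` are asymptotically
less informative than `F_n = (Q_{n,θ}, θ ∈ S)`, that is, `δ(F_n, E_n) → 0`. -/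
def AsympLessInformative {Θ : Type*} {X Y : ℕ → Type*} [∀ n, MeasurableSpace (X n)]
    [∀ n, MeasurableSpace (Y n)] (l : Filter ℕ) (S : Set Θ)
    (P : ∀ n, Θ → Measure (X n)) (Q : ∀ n, Θ → Measure (Y n)) : Prop :=
  Tendsto (fun n => deficiency S (Q n) (P n)) l (𝓝 0)

/-- The product experiment `E ⊗ F = (P_θ ⊗ Q_θ)`. -/
def prodExperiment {Θ X Y : Type*} [MeasurableSpace X] [MeasurableSpace Y]
    (P : Θ → Measure X) (Q : Θ → Measure Y) : Θ → Measure (X × Y) :=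
  fun θ => (P θ).prod (Q θ)

/-! ### Spectral densities

A function on `[-π, π]` is represented by a function on `ℝ`; nothing below depends on the values
outside `[-π, π]`. -/

/-- The Fourier coefficient `∫_{-π}^{π} exp(i k ω) f(ω) dω`. -/
def fourierCoef (f : ℝ → ℝ) (k : ℤ) : ℂ :=
  ∫ ω in (-π)..π, Complex.exp (Complex.I * k * ω) * f ω

/-- The autocovariance `γ_f(k)`. For even `f` the Fourier coefficient is real, see
`ofReal_autocov`, so that taking the real part only changes the type. -/
def autocov (f : ℝ → ℝ) (k : ℤ) : ℝ := (fourierCoef f k).re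

lemma ofReal_autocov {f : ℝ → ℝ} (hf : ∀ ω ∈ Icc (-π) π, f (-ω) = f ω) (k : ℤ) :
    (autocov f k : ℂ) = fourierCoef f k := by
  unfold autocov
  rw [← Complex.conj_eq_iff_re]
  unfold fourierCoef
  rw [intervalIntegral.integral_of_le (by linarith [Real.pi_pos]), ← integral_conj,
    ← intervalIntegral.integral_of_le (by linarith [Real.pi_pos]),
    ← intervalIntegral.integral_of_le (by linarith [Real.pi_pos])]
  have h := intervalIntegral.integral_comp_neg (a := -π) (b := π)
    (fun ω : ℝ => Complex.exp (Complex.I * k * ω) * f ω)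
  rw [neg_neg] at h
  rw [← h]
  refine intervalIntegral.integral_congr fun ω hω => ?_
  rw [uIcc_of_le (by linarith [Real.pi_pos])] at hω
  simp [hf ω hω, ← Complex.exp_conj]

/-- The Sobolev ball
`W^α(M) = {f ∈ L₂(-π, π) : γ_f(0)² + ∑_{k ∈ ℤ} |k|^{2α} |γ_f(k)|² ≤ M}`. -/
def sobolevBall (α M : ℝ) : Set (ℝ → ℝ) :=
  {f | MemLp f 2 (volume.restrict (Icc (-π) π)) ∧
    Summable (fun k : ℤ => |(k : ℝ)| ^ (2 * α) * ‖fourierCoef f k‖ ^ 2) ∧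
    ‖fourierCoef f 0‖ ^ 2 + ∑' k : ℤ, |(k : ℝ)| ^ (2 * α) * ‖fourierCoef f k‖ ^ 2 ≤ M}

/-- The even functions on `[-π, π]` that are bounded below by `M⁻¹`. -/
def evenBoundedBelow (M : ℝ) : Set (ℝ → ℝ) :=
  {f | ∀ ω ∈ Icc (-π) π, M⁻¹ ≤ f ω ∧ f (-ω) = f ω}

/-- The parameter space `Σ_{α, M}`. -/
def spectralClass (α M : ℝ) : Set (ℝ → ℝ) := sobolevBall α M ∩ evenBoundedBelow M

/-! ### The experiments -/

/-- The `n × n` Toeplitz covariance matrix `Γ_n(f)` with entries `γ_f(k - j)`. -/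
def toeplitzCov (n : ℕ) (f : ℝ → ℝ) : Matrix (Fin n) (Fin n) ℝ :=
  Matrix.of fun j k => autocov f ((k : ℤ) - (j : ℤ))

/-- `E_n`: the law `N_n(0, Γ_n(f))` of `n` successive observations of a centered stationary
Gaussian sequence with spectral density `f`. -/
def stationaryExperiment (n : ℕ) (f : ℝ → ℝ) : Measure (EuclideanSpace ℝ (Fin n)) :=
  multivariateGaussian 0 (toeplitzCov n f)

/-- The local averages `J_{j,n}(f) = n ∫_{(j-1)/n}^{j/n} f(2πx - π) dx`, `j = 1, …, n`; the index
`j : Fin n` stands for `j + 1`. -/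
def localAverage (n : ℕ) (f : ℝ → ℝ) (j : Fin n) : ℝ :=
  n * ∫ x in ((j : ℝ) / n)..(((j : ℝ) + 1) / n), f (2 * π * x - π)

/-- The Gaussian scale experiment of grid size `n`: the law `N_n(0, Diag(J_{j,n}(f)))` of
independent `z_j ∼ N(0, J_{j,n}(f))`, `j = 1, …, n`. -/
def scaleExperiment (n : ℕ) (f : ℝ → ℝ) : Measure (EuclideanSpace ℝ (Fin n)) :=
  multivariateGaussian 0 (Matrix.diagonal (localAverage n f))

/-- `r_n = 2 [(log n) / 2] + 1`, which is odd and asymptotic to `log n`. -/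
def gap (n : ℕ) : ℕ := 2 * ⌊Real.log n / 2⌋₊ + 1

/-- `m_n = (n - r_n) / 2`; for odd `n` the division is exact and `r_n ≤ n`, see
`two_mul_halfSize_add_gap`. -/
def halfSize (n : ℕ) : ℕ := (n - gap n) / 2

lemma two_mul_halfSize_add_gap {n : ℕ} (hn : Odd n) : 2 * halfSize n + gap n = n := by
  have h1 : gap n ≤ n := by
    have h0 : (0 : ℝ) ≤ Real.log n / 2 := by
      have := Real.log_natCast_nonneg n
      linarith
    have hpos : (0 : ℝ) < n := by exact_mod_cast hn.pos
    have h2 := Nat.floor_le h0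
    have h3 := Real.log_le_sub_one_of_pos hpos
    have h4 : (gap n : ℝ) ≤ n := by
      unfold gap
      push_cast
      linarith
    exact_mod_cast h4
  obtain ⟨a, ha⟩ := hn
  unfold halfSize
  have : gap n = 2 * ⌊Real.log n / 2⌋₊ + 1 := rfl
  omega

/-- The lower bracket experiment: the product of two Gaussian scale experiments of grid size
`(n - r_n) / 2`. -/
def lowerBracket (n : ℕ) :
    (ℝ → ℝ) → Measure (EuclideanSpace ℝ (Fin (halfSize n)) × EuclideanSpace ℝ (Fin (halfSize n))) :=
  prodExperiment (scaleExperiment (halfSize n)) (scaleExperiment (halfSize n))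

end GaussTS

end

noncomputable section

namespace GaussTS

/-! ### Total variation distance -/

/-! The kernel is deterministic and linear. Put `r = gap n`, `m = halfSize n`, so that `2 * m + r =
n`. The last `r` observations are blended into the first `r` with weights `-cos θ` and `sin θ`,
where `θ` climbs from `0` to `π / 2`. The resulting vector of length `2 * m` continues almost
seamlessly into its own negative, so its covariance is nearly skew-circulant. Since `sin² + cos² =
1`, the contribution of the lag-zero covariance to the variances is unchanged. The orthogonal
Hartley transform diagonalizes every symmetric skew-circulant matrix; its eigenvalues are values of
the truncated Fourier series of `2πf` at `2 * m` half-integer frequencies, two in each of the `m`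
cells of the grid. Each eigenvalue is close to `2π` times the average of `f` over its cell, and the
two frequencies per cell supply the two independent copies.

Everything is measured in squared Frobenius norm, with `p = 2 * min α 1`, so `1 < p ≤ 2`. Blending
costs about `r * (d / r) ^ p` at lag `d`; against the Sobolev bound this sums to a multiple of `r ^
(1 - p)` (`frobSq_overlapAdd_sub_skewCirculant_le`). Passing to cell averages costs a multiple of `m
^ (1 - p)` (`sum_sq_cosSum_sub_localAverage_le`). Both tend to zero because `p > 1` and `r` grows
like `log n`.

The lower bound `M⁻¹` on `f` bounds the target variances from below, so Frobenius closeness becomes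
closeness in total variation (`tvDist_multivariateGaussian_diagonal_le`): whitening and rotation
reduce this to independent coordinates, where the `χ²` distance factorizes. -/

lemma tvDist_le_ofReal {X : Type*} [MeasurableSpace X] {P Q : Measure X} {c : ℝ}
    (h : ∀ A, MeasurableSet A → |P.real A - Q.real A| ≤ c) : tvDist P Q ≤ ENNReal.ofReal c :=
  iSup₂_le fun A hA => ENNReal.ofReal_le_ofReal (h A hA)

lemma tvDist_map_le {X Y : Type*} [MeasurableSpace X] [MeasurableSpace Y] (P Q : Measure X)
    {g : X → Y} (hg : Measurable g) : tvDist (P.map g) (Q.map g) ≤ tvDist P Q := by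
  refine iSup₂_le fun A hA => ?_
  rw [map_measureReal_apply hg hA, map_measureReal_apply hg hA]
  exact le_iSup₂ (f := fun (A : Set X) (_ : MeasurableSet A) =>
    ENNReal.ofReal |P.real A - Q.real A|) (g ⁻¹' A) (hg hA)

lemma tvDist_comm {X : Type*} [MeasurableSpace X] (P Q : Measure X) :
    tvDist P Q = tvDist Q P := by
  simp only [tvDist, abs_sub_comm]

/-- The total variation distance is bounded by the `χ²` distance. -/
lemma abs_measureReal_sub_le_sqrt {X : Type*} [MeasurableSpace X] {P Q : Measure X}
    [IsProbabilityMeasure P] [IsProbabilityMeasure Q] {p : X → ℝ} (hp0 : ∀ x, 0 ≤ p x)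
    (hp : Integrable p Q) (hp2 : Integrable (fun x => p x ^ 2) Q)
    (hP : P = Q.withDensity fun x => ENNReal.ofReal (p x)) {A : Set X} (hA : MeasurableSet A) :
    |P.real A - Q.real A| ≤ √(∫ x, p x ^ 2 ∂Q - 1) := by
  have hreal : ∀ B, MeasurableSet B → P.real B = ∫ x in B, p x ∂Q := by
    intro B hB
    rw [integral_eq_lintegral_of_nonneg_ae (ae_of_all _ hp0) hp.aestronglyMeasurable.restrict,
      Measure.real, hP, withDensity_apply _ hB]
  have h1 : ∫ x, p x ∂Q = 1 := by
    have := hreal univ MeasurableSet.univ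
    simpa using this.symm
  have hi : Integrable (fun x => p x - 1) Q := hp.sub (integrable_const _)
  have hi2 : Integrable (fun x => (p x - 1) ^ 2) Q := by
    have : (fun x => (p x - 1) ^ 2) = fun x => p x ^ 2 - 2 * p x + 1 := by ext; ring
    rw [this]
    exact (hp2.sub (hp.const_mul 2)).add (integrable_const _)
  have hval : ∫ x, (p x - 1) ^ 2 ∂Q = ∫ x, p x ^ 2 ∂Q - 1 := by
    have : (fun x => (p x - 1) ^ 2) = fun x => p x ^ 2 - 2 * p x + 1 := by ext; ring
    have hs : Integrable (fun x => p x ^ 2 - 2 * p x) Q := hp2.sub (hp.const_mul 2)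
    rw [this, integral_add hs (integrable_const _),
      integral_sub hp2 (hp.const_mul 2), integral_const_mul, h1]
    simp
    ring
  have hA1 : P.real A - Q.real A = ∫ x in A, (p x - 1) ∂Q := by
    rw [integral_sub hp.integrableOn (integrable_const _).integrableOn, hreal A hA]
    simp
  have hA2 : |∫ x in A, (p x - 1) ∂Q| ≤ ∫ x, |p x - 1| ∂Q :=
    (abs_integral_le_integral_abs).trans
      (setIntegral_le_integral hi.abs (ae_of_all _ fun x => abs_nonneg _))
  -- Cauchy–Schwarz, read off from the nonnegative variance of `|p - 1|` under `Q`.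
  have hvar : (∫ x, |p x - 1| ∂Q) ^ 2 ≤ ∫ x, (p x - 1) ^ 2 ∂Q := by
    set c := ∫ x, |p x - 1| ∂Q with hc
    have h0 : 0 ≤ ∫ x, (|p x - 1| - c) ^ 2 ∂Q := integral_nonneg fun x => sq_nonneg _
    have he : (fun x => (|p x - 1| - c) ^ 2) =
        fun x => (p x - 1) ^ 2 - 2 * c * |p x - 1| + c ^ 2 := by
      ext x
      rw [sub_sq, sq_abs]
      ring
    have hs : Integrable (fun x => (p x - 1) ^ 2 - 2 * c * |p x - 1|) Q :=
      hi2.sub (hi.abs.const_mul _)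
    rw [he, integral_add hs (integrable_const _),
      integral_sub hi2 (hi.abs.const_mul _), integral_const_mul, ← hc] at h0
    simp at h0
    nlinarith
  rw [hA1, ← hval]
  exact hA2.trans (Real.le_sqrt_of_sq_le hvar)

/-! ### One-dimensional Gaussian likelihood ratios -/

/-- The density of `N(0, v)` with respect to `N(0, 1)`. -/
def gaussRatio (v x : ℝ) : ℝ := (√v)⁻¹ * Real.exp (-((v⁻¹ - 1) / 2) * x ^ 2)

lemma gaussRatio_nonneg (v x : ℝ) : 0 ≤ gaussRatio v x := by unfold gaussRatio; positivity

lemma gaussRatio_sq {v : ℝ} (hv : 0 < v) (x : ℝ) :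
    gaussRatio v x ^ 2 = v⁻¹ * Real.exp (-(v⁻¹ - 1) * x ^ 2) := by
  rw [gaussRatio, mul_pow, inv_pow, Real.sq_sqrt hv.le, ← Real.exp_nat_mul]
  congr 2
  push_cast
  ring

lemma gaussianReal_one_eq_withDensity :
    gaussianReal 0 1 = volume.withDensity (gaussianPDF 0 1) :=
  gaussianReal_of_var_ne_zero 0 one_ne_zero

lemma gaussianPDFReal_zero_one_mul_exp (b x : ℝ) :
    gaussianPDFReal 0 1 x * Real.exp (-b * x ^ 2) =
      (√(2 * π))⁻¹ * Real.exp (-(b + 1 / 2) * x ^ 2) := by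
  rw [gaussianPDFReal_def]
  simp only [NNReal.coe_one, mul_one, sub_zero]
  rw [mul_assoc, ← Real.exp_add]
  congr 2
  ring

lemma integrable_exp_neg_mul_sq_gaussianReal {b : ℝ} (hb : 0 < 1 + 2 * b) :
    Integrable (fun x => Real.exp (-b * x ^ 2)) (gaussianReal 0 1) := by
  rw [gaussianReal_one_eq_withDensity, integrable_withDensity_iff_integrable_smul'
    (measurable_gaussianPDF 0 1) (ae_of_all _ fun x => gaussianPDF_lt_top)]
  simp only [toReal_gaussianPDF, smul_eq_mul, gaussianPDFReal_zero_one_mul_exp]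
  exact (integrable_exp_neg_mul_sq (by linarith)).const_mul _

lemma integral_exp_neg_mul_sq_gaussianReal {b : ℝ} (hb : 0 < 1 + 2 * b) :
    ∫ x, Real.exp (-b * x ^ 2) ∂(gaussianReal 0 1) = (√(1 + 2 * b))⁻¹ := by
  rw [integral_gaussianReal_eq_integral_smul one_ne_zero]
  simp only [smul_eq_mul, gaussianPDFReal_zero_one_mul_exp]
  rw [integral_const_mul, integral_gaussian, ← Real.sqrt_inv, ← Real.sqrt_inv,
    ← Real.sqrt_mul (by positivity)]
  congr 1
  have := Real.pi_pos.ne'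
  have h2 : 1 + 2 * b ≠ 0 := hb.ne'
  rw [show b + 1 / 2 = (1 + 2 * b) / 2 by ring]
  field_simp

lemma gaussianReal_eq_withDensity_gaussRatio {v : ℝ} (hv : 0 < v) :
    gaussianReal 0 v.toNNReal =
      (gaussianReal 0 1).withDensity fun x => ENNReal.ofReal (gaussRatio v x) := by
  have hm : Measurable fun x => ENNReal.ofReal (gaussRatio v x) := by
    unfold gaussRatio; fun_prop
  rw [gaussianReal_one_eq_withDensity, ← withDensity_mul _ (measurable_gaussianPDF 0 1) hm,
    gaussianReal_of_var_ne_zero 0 (by simpa using hv)]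
  congr 1
  ext x
  simp only [Pi.mul_apply, gaussianPDF]
  rw [← ENNReal.ofReal_mul (gaussianPDFReal_nonneg _ _ _)]
  congr 1
  rw [gaussRatio, mul_left_comm, gaussianPDFReal_zero_one_mul_exp, gaussianPDFReal_def,
    Real.coe_toNNReal v hv.le, ← mul_assoc, ← mul_inv, ← Real.sqrt_mul hv.le]
  rw [show v * (2 * π) = 2 * π * v by ring]
  simp only [sub_zero]
  congr 2
  field_simp
  ring

lemma integrable_gaussRatio_sq {v : ℝ} (hv : 0 < v) (hv2 : v < 2) :
    Integrable (fun x => gaussRatio v x ^ 2) (gaussianReal 0 1) := by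
  have h : (2 : ℝ)⁻¹ < v⁻¹ := inv_strictAnti₀ hv hv2
  simp only [gaussRatio_sq hv]
  exact (integrable_exp_neg_mul_sq_gaussianReal (by linarith)).const_mul _

lemma integrable_gaussRatio {v : ℝ} (hv : 0 < v) :
    Integrable (gaussRatio v) (gaussianReal 0 1) := by
  have h : 0 < v⁻¹ := inv_pos.2 hv
  exact (integrable_exp_neg_mul_sq_gaussianReal (by linarith)).const_mul _

/-- The second moment is exactly `(1 - x) ^ (-1/2)` with `x = (v - 1) ^ 2`, and `(1 - x)⁻¹ ≤ 1 + 2 *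
x ≤ exp (2 * x)` for `x ≤ 1 / 4`. The exponential form turns products over coordinates into sums. -/
lemma integral_gaussRatio_sq_le {v : ℝ} (hv : |v - 1| ≤ 1 / 2) :
    ∫ x, gaussRatio v x ^ 2 ∂(gaussianReal 0 1) ≤ Real.exp ((v - 1) ^ 2) := by
  obtain ⟨h1, h2⟩ := abs_le.1 hv
  have hv0 : 0 < v := by linarith
  have h : (2 : ℝ)⁻¹ < v⁻¹ := inv_strictAnti₀ hv0 (by linarith)
  simp only [gaussRatio_sq hv0]
  rw [integral_const_mul, integral_exp_neg_mul_sq_gaussianReal (by linarith)]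
  have hs : v⁻¹ * (√(1 + 2 * (v⁻¹ - 1)))⁻¹ = √((1 - (v - 1) ^ 2)⁻¹) := by
    have : v⁻¹ = √((v⁻¹) ^ 2) := (Real.sqrt_sq (by positivity)).symm
    rw [← Real.sqrt_inv]
    nth_rw 1 [this]
    rw [← Real.sqrt_mul (by positivity)]
    congr 1
    rw [inv_pow, ← mul_inv]
    congr 1
    field_simp
    ring
  rw [hs, Real.sqrt_le_left (Real.exp_pos _).le, ← Real.exp_nat_mul]
  set x := (v - 1) ^ 2 with hx
  have hx0 : 0 ≤ x := sq_nonneg _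
  have hx1 : x ≤ 1 / 4 := by rw [hx]; nlinarith
  have hexp : 1 + (2 : ℕ) * x ≤ Real.exp ((2 : ℕ) * x) := by
    linarith [Real.add_one_le_exp (((2 : ℕ) : ℝ) * x)]
  refine le_trans ?_ hexp
  rw [inv_le_iff_one_le_mul₀ (by linarith)]
  push_cast
  nlinarith

/-! ### Products of Gaussians -/

section Pi

variable {ι : Type*} [Fintype ι]

/-- Boxes determine a product measure, and on a box both the indicator and the density factor over
the coordinates, so the integral is a product. -/
lemma pi_withDensity_ofReal {X : ι → Type*} [∀ i, MeasurableSpace (X i)] (μ : ∀ i, Measure (X i))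
    [∀ i, IsProbabilityMeasure (μ i)] (p : ∀ i, X i → ℝ) (hp0 : ∀ i x, 0 ≤ p i x)
    (hp : ∀ i, Integrable (p i) (μ i)) :
    Measure.pi (fun i => (μ i).withDensity fun x => ENNReal.ofReal (p i x)) =
      (Measure.pi μ).withDensity fun x => ENNReal.ofReal (∏ i, p i (x i)) := by
  have hfin : ∀ i, IsFiniteMeasure ((μ i).withDensity fun x => ENNReal.ofReal (p i x)) :=
    fun i => isFiniteMeasure_withDensity_ofReal (hp i).2
  have key : ∀ (i : ι) (s : Set (X i)), MeasurableSet s →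
      ENNReal.ofReal (∫ x, s.indicator (p i) x ∂(μ i)) =
        (μ i).withDensity (fun x => ENNReal.ofReal (p i x)) s := by
    intro i s hs
    rw [withDensity_apply _ hs, integral_indicator hs,
      ofReal_integral_eq_lintegral_ofReal (hp i).integrableOn (ae_of_all _ (hp0 i))]
  refine Measure.pi_eq fun s hs => ?_
  rw [withDensity_apply _ (MeasurableSet.univ_pi hs),
    ← ofReal_integral_eq_lintegral_ofReal
      (Integrable.fintype_prod_dep fun i => hp i).integrableOn
      (ae_of_all _ fun x => Finset.prod_nonneg fun i _ => hp0 i _),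
    ← integral_indicator (MeasurableSet.univ_pi hs)]
  have : (fun x : ∀ i, X i => (univ.pi s).indicator (fun x => ∏ i, p i (x i)) x) =
      fun x => ∏ i, (s i).indicator (p i) (x i) := by
    ext x
    by_cases hx : x ∈ univ.pi s
    · rw [indicator_of_mem hx]
      exact Finset.prod_congr rfl fun i _ => (indicator_of_mem (hx i (mem_univ i)) _).symm
    · rw [indicator_of_notMem hx]
      simp only [Set.mem_pi, mem_univ, forall_const, not_forall] at hx
      obtain ⟨i, hi⟩ := hx
      exact (Finset.prod_eq_zero (Finset.mem_univ i) (indicator_of_notMem hi _)).symm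
  rw [this, integral_fintype_prod_eq_prod (f := fun i => (s i).indicator (p i)),
    ENNReal.ofReal_prod_of_nonneg fun i _ =>
      integral_nonneg fun x => indicator_nonneg (fun x _ => hp0 i x) x]
  exact Finset.prod_congr rfl fun i _ => key i _ (hs i)

/-- The second moment of a product likelihood ratio is the product of the second moments, so the
`χ²` bound sees only the sum of `(v i - 1) ^ 2`. -/
lemma tvDist_pi_gaussianReal_le {v : ι → ℝ} (hv : ∀ i, |v i - 1| ≤ 1 / 2) :
    tvDist (Measure.pi fun i => gaussianReal 0 (v i).toNNReal)
      (Measure.pi fun _ : ι => gaussianReal 0 1) ≤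
        ENNReal.ofReal (√(Real.exp (∑ i, (v i - 1) ^ 2) - 1)) := by
  have hv0 : ∀ i, 0 < v i := fun i => by linarith [(abs_le.1 (hv i)).1]
  have hv2 : ∀ i, v i < 2 := fun i => by linarith [(abs_le.1 (hv i)).2]
  have h1 : Integrable (fun x : ι → ℝ => ∏ i, gaussRatio (v i) (x i))
      (Measure.pi fun _ : ι => gaussianReal 0 1) :=
    Integrable.fintype_prod_dep fun i => integrable_gaussRatio (hv0 i)
  have h2 : Integrable (fun x : ι → ℝ => (∏ i, gaussRatio (v i) (x i)) ^ 2)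
      (Measure.pi fun _ : ι => gaussianReal 0 1) := by
    simp only [← Finset.prod_pow]
    exact Integrable.fintype_prod_dep (f := fun i x => gaussRatio (v i) x ^ 2)
      fun i => integrable_gaussRatio_sq (hv0 i) (hv2 i)
  have h3 : (Measure.pi fun i => gaussianReal 0 (v i).toNNReal) =
      (Measure.pi fun _ : ι => gaussianReal 0 1).withDensity
        fun x => ENNReal.ofReal (∏ i, gaussRatio (v i) (x i)) := by
    rw [← pi_withDensity_ofReal (fun _ : ι => gaussianReal 0 1) (fun i => gaussRatio (v i))
      (fun i => gaussRatio_nonneg (v i)) fun i => integrable_gaussRatio (hv0 i)]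
    exact congrArg _ (funext fun i => gaussianReal_eq_withDensity_gaussRatio (hv0 i))
  refine tvDist_le_ofReal fun A hA => ?_
  refine (abs_measureReal_sub_le_sqrt
    (fun x => Finset.prod_nonneg fun i _ => gaussRatio_nonneg _ _) h1 h2 h3 hA).trans ?_
  apply Real.sqrt_le_sqrt
  apply sub_le_sub_right
  simp only [← Finset.prod_pow]
  rw [integral_fintype_prod_eq_prod (f := fun i x => gaussRatio (v i) x ^ 2), Real.exp_sum]
  exact Finset.prod_le_prod (fun i _ => integral_nonneg fun x => sq_nonneg _)
    fun i _ => integral_gaussRatio_sq_le (hv i)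

end Pi

/-! ### Frobenius norm and Gaussian laws -/

section Matrix

open Matrix

variable {ι κ : Type*} [Fintype ι] [Fintype κ]

/-- The squared Frobenius norm. -/
def frobSq (X : Matrix κ ι ℝ) : ℝ := ∑ i, ∑ j, X i j ^ 2

lemma frobSq_nonneg (X : Matrix κ ι ℝ) : 0 ≤ frobSq X :=
  Finset.sum_nonneg fun _ _ => Finset.sum_nonneg fun _ _ => sq_nonneg _

lemma frobSq_eq_trace (X : Matrix κ ι ℝ) : frobSq X = (X * Xᵀ).trace := by
  simp [frobSq, trace, mul_apply, sq]

lemma frobSq_add_le (X Y : Matrix κ ι ℝ) : frobSq (X + Y) ≤ 2 * frobSq X + 2 * frobSq Y := by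
  simp only [frobSq, Finset.mul_sum, ← Finset.sum_add_distrib]
  refine Finset.sum_le_sum fun i _ => Finset.sum_le_sum fun j _ => ?_
  rw [Matrix.add_apply]
  nlinarith [sq_nonneg (X i j - Y i j)]

lemma frobSq_smul (c : ℝ) (X : Matrix κ ι ℝ) : frobSq (c • X) = c ^ 2 * frobSq X := by
  simp [frobSq, Finset.mul_sum, mul_pow]

lemma frobSq_diagonal [DecidableEq ι] (d : ι → ℝ) : frobSq (diagonal d) = ∑ i, d i ^ 2 := by
  rw [frobSq_eq_trace]
  simp [trace_diagonal, sq]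

lemma frobSq_conj [DecidableEq ι] {H : Matrix κ ι ℝ} (hH : Hᵀ * H = 1) (X : Matrix ι ι ℝ) :
    frobSq (H * X * Hᵀ) = frobSq X := by
  rw [frobSq_eq_trace, frobSq_eq_trace]
  have : H * X * Hᵀ * (H * X * Hᵀ)ᵀ = H * (X * (Hᵀ * H) * Xᵀ * Hᵀ) := by
    simp only [transpose_mul, transpose_transpose, Matrix.mul_assoc]
  rw [this, hH, trace_mul_comm, Matrix.mul_assoc, hH, Matrix.mul_one, Matrix.mul_one]

variable [DecidableEq ι] [DecidableEq κ]

/-- The law of a linear image of a centered Gaussian vector. -/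
lemma map_multivariateGaussian {S : Matrix ι ι ℝ} (hS : S.PosSemidef) (L : Matrix κ ι ℝ) :
    (multivariateGaussian 0 S).map (fun x => WithLp.toLp 2 (L *ᵥ x.ofLp)) =
      multivariateGaussian 0 (L * S * Lᵀ) := by
  have hm : Measurable fun x : EuclideanSpace ℝ ι => WithLp.toLp 2 (L *ᵥ x.ofLp) := by
    refine (WithLp.measurable_toLp 2 _).comp ?_
    exact (Continuous.matrix_mulVec continuous_const continuous_id).measurable.comp
      (WithLp.measurable_ofLp 2 _)
  have : IsProbabilityMeasure ((multivariateGaussian 0 S).map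
      (fun x => WithLp.toLp 2 (L *ᵥ x.ofLp))) :=
    Measure.isProbabilityMeasure_map hm.aemeasurable
  have hLS : (L * S * Lᵀ).PosSemidef := by
    simpa using hS.mul_mul_conjTranspose_same L
  apply Measure.ext_of_charFun
  ext t
  have h : charFun ((multivariateGaussian 0 S).map (fun x => WithLp.toLp 2 (L *ᵥ x.ofLp))) t =
      charFun (multivariateGaussian 0 S) (WithLp.toLp 2 (Lᵀ *ᵥ t.ofLp)) := by
    rw [charFun_apply, charFun_apply, integral_map hm.aemeasurable (by fun_prop)]
    congr 1
    ext x
    congr 3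
    simp only [EuclideanSpace.inner_eq_star_dotProduct, star_trivial]
    rw [dotProduct_mulVec, ← mulVec_transpose]
  rw [h, charFun_multivariateGaussian hS, charFun_multivariateGaussian hLS]
  congr 4
  · simp
  · simp only [← mulVec_mulVec]
    rw [dotProduct_mulVec (t.ofLp) L, ← mulVec_transpose]

lemma multivariateGaussian_diagonal {d : ι → ℝ} (hd : ∀ i, 0 ≤ d i) :
    multivariateGaussian 0 (diagonal d) =
      (Measure.pi fun i => gaussianReal 0 (d i).toNNReal).map (WithLp.toLp 2) := by
  have : IsProbabilityMeasure ((Measure.pi fun i => gaussianReal 0 (d i).toNNReal).map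
      (WithLp.toLp 2)) :=
    Measure.isProbabilityMeasure_map (WithLp.measurable_toLp 2 _).aemeasurable
  apply Measure.ext_of_charFun
  ext t
  rw [charFun_multivariateGaussian (PosSemidef.diagonal hd), charFun_pi]
  simp only [charFun_gaussianReal, ← Complex.exp_sum]
  congr 1
  simp only [inner_zero_right, Complex.ofReal_zero, zero_mul, zero_sub, mul_zero,
    Real.coe_toNNReal _ (hd _), dotProduct, mulVec_diagonal]
  push_cast
  rw [Finset.sum_div, ← Finset.sum_neg_distrib]
  refine Finset.sum_congr rfl fun i _ => ?_
  ring

/-- Two centered Gaussian laws, one of them with independent coordinates of variances at least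
`c`, are close in total variation if the covariances are close in Frobenius norm. -/
lemma tvDist_multivariateGaussian_diagonal_le {A : Matrix ι ι ℝ} (hA : A.PosSemidef)
    {d : ι → ℝ} {c : ℝ} (hc : 0 < c) (hd : ∀ i, c ≤ d i)
    (hF : frobSq (A - diagonal d) ≤ c ^ 2 / 4) :
    tvDist (multivariateGaussian 0 A) (multivariateGaussian 0 (diagonal d)) ≤
      ENNReal.ofReal (√(2 * (frobSq (A - diagonal d) / c ^ 2))) := by
  have hd0 : ∀ i, 0 < d i := fun i => hc.trans_le (hd i)
  -- Whitening by `d ^ (-1/2)` and rotating to the eigenbasis of the whitened `A` exhibits `A` and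
  -- `diagonal d` as congruences, by one matrix `G`, of `diagonal v` and the identity. Total
  -- variation does not increase under `G`.
  set s : ι → ℝ := fun i => √(d i) with hs
  have hs0 : ∀ i, 0 < s i := fun i => Real.sqrt_pos.2 (hd0 i)
  have hss : ∀ i, s i * s i = d i := fun i => Real.mul_self_sqrt (hd0 i).le
  set R : Matrix ι ι ℝ := diagonal fun i => (s i)⁻¹ with hR
  set B := R * A * R with hB
  have hBp : B.PosSemidef := by
    have := hA.mul_mul_conjTranspose_same R
    rwa [conjTranspose_eq_transpose_of_trivial, hR, diagonal_transpose] at this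
  set U : Matrix ι ι ℝ := (hBp.1.eigenvectorUnitary : Matrix ι ι ℝ) with hU
  set v := hBp.1.eigenvalues with hv
  have hUU : U * Uᵀ = 1 := by
    simpa [star_eq_conjTranspose] using Unitary.coe_mul_star_self hBp.1.eigenvectorUnitary
  have hUU' : Uᵀ * U = 1 := mul_eq_one_comm.1 hUU
  have hBU : B = U * diagonal v * Uᵀ := by
    have := hBp.1.spectral_theorem
    rw [Unitary.conjStarAlgAut_apply] at this
    simpa [star_eq_conjTranspose] using this
  set G := diagonal s * U with hG
  have hsR : diagonal s * R = 1 := by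
    rw [hR, diagonal_mul_diagonal]
    simp [(hs0 _).ne']
  have hRs : R * diagonal s = 1 := mul_eq_one_comm.1 hsR
  have hAG : A = G * diagonal v * Gᵀ := by
    rw [hG, transpose_mul, diagonal_transpose]
    calc A = (diagonal s * R) * A * (R * diagonal s) := by rw [hsR, hRs]; simp
      _ = diagonal s * B * diagonal s := by rw [hB]; simp only [Matrix.mul_assoc]
      _ = _ := by rw [hBU]; simp only [Matrix.mul_assoc]
  have hdG : diagonal d = G * Matrix.diagonal (fun _ : ι => (1 : ℝ)) * Gᵀ := by
    rw [hG, transpose_mul, diagonal_transpose, diagonal_one, Matrix.mul_one]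
    calc diagonal d = diagonal s * 1 * diagonal s := by
          rw [Matrix.mul_one, diagonal_mul_diagonal]; simp [hss]
      _ = _ := by rw [← hUU]; simp only [Matrix.mul_assoc]
  -- Whitening divides the entry `(i, j)` by `s i * s j ≥ c`; the rotation preserves the Frobenius
  -- norm.
  have hfr : ∑ i, (v i - 1) ^ 2 ≤ frobSq (A - diagonal d) / c ^ 2 := by
    have h1 : B - 1 = U * diagonal (fun i => v i - 1) * Uᵀ := by
      have : diagonal (fun i => v i - 1) = diagonal v - (1 : Matrix ι ι ℝ) := by
        rw [← diagonal_one, diagonal_sub]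
      rw [this, Matrix.mul_sub, Matrix.sub_mul, ← hBU, Matrix.mul_one, hUU]
    rw [← frobSq_diagonal, ← frobSq_conj hUU', ← h1, le_div_iff₀ (by positivity), frobSq, frobSq,
      Finset.sum_mul]
    refine Finset.sum_le_sum fun i _ => ?_
    rw [Finset.sum_mul]
    refine Finset.sum_le_sum fun j _ => ?_
    have h2 : (B - 1) i j = (A - diagonal d) i j * ((s i)⁻¹ * (s j)⁻¹) := by
      rw [Matrix.sub_apply, Matrix.sub_apply, hB, hR, mul_diagonal, diagonal_mul,
        one_apply, diagonal_apply]
      split_ifs with hij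
      · subst hij
        have := hss i
        have h0 := (hs0 i).ne'
        rw [← this]
        field_simp
      · ring
    rw [h2, mul_pow, mul_assoc]
    refine mul_le_of_le_one_right (sq_nonneg _) ?_
    rw [← mul_pow]
    have hcs : ∀ i, √c ≤ s i := fun i => Real.sqrt_le_sqrt (hd i)
    have hc' : c = √c * √c := (Real.mul_self_sqrt hc.le).symm
    have h3 : (s i)⁻¹ * (s j)⁻¹ * c ≤ 1 := by
      rw [← mul_inv, inv_mul_le_iff₀ (mul_pos (hs0 i) (hs0 j)), mul_one, hc']
      exact mul_le_mul (hcs i) (hcs j) (Real.sqrt_nonneg _) (hs0 i).le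
    have h4 : 0 ≤ (s i)⁻¹ * (s j)⁻¹ * c := by
      have := hs0 i; have := hs0 j; positivity
    exact pow_le_one₀ h4 h3
  set q := frobSq (A - diagonal d) / c ^ 2 with hq
  -- This forces every eigenvalue to within `1 / 2` of `1`, as the coordinatewise `χ²` bound
  -- requires.
  have hq1 : q ≤ 1 / 4 := by
    rw [hq, div_le_iff₀ (by positivity)]
    linarith
  have hq0 : 0 ≤ q := div_nonneg (frobSq_nonneg _) (sq_nonneg _)
  have hv1 : ∀ i, |v i - 1| ≤ 1 / 2 := by
    intro i
    have : (v i - 1) ^ 2 ≤ (1 / 2) ^ 2 := by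
      have := Finset.single_le_sum (f := fun i => (v i - 1) ^ 2) (fun i _ => sq_nonneg _)
        (Finset.mem_univ i)
      norm_num
      linarith
    exact abs_le_of_sq_le_sq this (by norm_num)
  have hv0 : ∀ i, 0 ≤ v i := fun i => hBp.eigenvalues_nonneg i
  have hmeas : Measurable fun x : EuclideanSpace ℝ ι => WithLp.toLp 2 (G *ᵥ x.ofLp) := by
    refine (WithLp.measurable_toLp 2 _).comp ?_
    exact (Continuous.matrix_mulVec continuous_const continuous_id).measurable.comp
      (WithLp.measurable_ofLp 2 _)
  rw [hAG, hdG, ← map_multivariateGaussian (PosSemidef.diagonal hv0),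
    ← map_multivariateGaussian (PosSemidef.diagonal fun _ => zero_le_one)]
  refine (tvDist_map_le _ _ hmeas).trans ?_
  rw [multivariateGaussian_diagonal hv0, multivariateGaussian_diagonal fun _ => zero_le_one]
  refine (tvDist_map_le _ _ (WithLp.measurable_toLp 2 _)).trans ?_
  simp only [Real.toNNReal_one]
  refine (tvDist_pi_gaussianReal_le hv1).trans (ENNReal.ofReal_le_ofReal (Real.sqrt_le_sqrt ?_))
  have h5 : Real.exp (∑ i, (v i - 1) ^ 2) ≤ Real.exp q := Real.exp_le_exp.2 hfr
  have h6 := Real.abs_exp_sub_one_le (x := q) (by rw [abs_of_nonneg hq0]; linarith)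
  rw [abs_of_nonneg hq0] at h6
  linarith [le_abs_self (Real.exp q - 1)]

end Matrix

/-! ### The Hartley transform at half-integer frequencies -/

/-- The frequencies `-π + (k + 1/2) π / m`, `k = 0, …, 2m - 1`. -/
def hartleyFreq (m k : ℕ) : ℝ := -π + (2 * k + 1) * π / (2 * m)

/-- The enumeration of the frequencies by `Fin m ⊕ Fin m` that puts two neighbouring
frequencies into each of the `m` cells of the grid. -/
def hartleyLabel (m : ℕ) : Fin m ⊕ Fin m → ℕ :=
  Sum.elim (fun j => 2 * (j : ℕ)) (fun j => 2 * (j : ℕ) + 1)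

lemma sum_hartleyLabel (m : ℕ) (F : ℕ → ℝ) :
    ∑ k, F (hartleyLabel m k) = ∑ k ∈ Finset.range (2 * m), F k := by
  rw [Fintype.sum_sum_type]
  simp only [hartleyLabel, Sum.elim_inl, Sum.elim_inr]
  rw [Fin.sum_univ_eq_sum_range (fun j => F (2 * j)) m,
    Fin.sum_univ_eq_sum_range (fun j => F (2 * j + 1)) m, ← Finset.sum_add_distrib]
  induction m with
  | zero => simp
  | succ m ih =>
    rw [Finset.sum_range_succ, ih, show 2 * (m + 1) = 2 * m + 1 + 1 by ring,
      Finset.sum_range_succ, Finset.sum_range_succ]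
    ring

lemma hartleyFreq_reflect {m k : ℕ} (hk : k < 2 * m) :
    hartleyFreq m (2 * m - 1 - k) = -hartleyFreq m k := by
  have hm : (m : ℝ) ≠ 0 := by
    rintro h
    have : m = 0 := by exact_mod_cast h
    omega
  have h : ((2 * m - 1 - k : ℕ) : ℝ) = 2 * m - 1 - k := by
    rw [Nat.sub_sub, Nat.cast_sub (by omega)]
    push_cast
    ring
  rw [hartleyFreq, hartleyFreq, h]
  field_simp
  ring

/-- The frequencies are symmetric about `0`, so the reflection `k ↦ 2 * m - 1 - k` reverses the sign
of the sum. -/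
lemma sum_mul_sin_hartleyFreq (m : ℕ) (G : ℕ → ℝ) (hG : ∀ k < 2 * m, G (2 * m - 1 - k) = G k)
    (t : ℝ) : ∑ k ∈ Finset.range (2 * m), G k * Real.sin (hartleyFreq m k * t) = 0 := by
  have h := Finset.sum_range_reflect (fun k => G k * Real.sin (hartleyFreq m k * t)) (2 * m)
  have h2 : ∑ k ∈ Finset.range (2 * m), G (2 * m - 1 - k) *
      Real.sin (hartleyFreq m (2 * m - 1 - k) * t) =
      -∑ k ∈ Finset.range (2 * m), G k * Real.sin (hartleyFreq m k * t) := by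
    rw [← Finset.sum_neg_distrib]
    refine Finset.sum_congr rfl fun k hk => ?_
    rw [hG k (Finset.mem_range.1 hk), hartleyFreq_reflect (Finset.mem_range.1 hk), neg_mul,
      Real.sin_neg]
    ring
  linarith

/-- Multiplying by `2 * sin h`, with `h` half the phase step, makes the sum telescope to sines at
`±tπ`, which vanish. Non-divisibility gives `sin h ≠ 0`. -/
lemma sum_cos_hartleyFreq_of_not_dvd {m : ℕ} (hm : 0 < m) {t : ℤ} (ht : ¬ (2 * m : ℤ) ∣ t) :
    ∑ k ∈ Finset.range (2 * m), Real.cos (hartleyFreq m k * t) = 0 := by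
  have hm0 : (m : ℝ) ≠ 0 := by positivity
  set h : ℝ := π * t / (2 * m) with hh
  have hsin : Real.sin h ≠ 0 := by
    intro h0
    obtain ⟨q, hq⟩ := Real.sin_eq_zero_iff.1 h0
    apply ht
    refine ⟨q, ?_⟩
    have hpi := Real.pi_pos.ne'
    rw [hh] at hq
    field_simp at hq
    have : (t : ℝ) = ((2 * m * q : ℤ) : ℝ) := by
      push_cast
      linarith
    exact_mod_cast this
  have htel : ∀ k : ℕ, 2 * Real.sin h * Real.cos (hartleyFreq m k * t) =
      Real.sin (-(π * t) + 2 * ((k + 1 : ℕ) : ℝ) * h) - Real.sin (-(π * t) + 2 * (k : ℝ) * h) := by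
    intro k
    have e1 : -(π * t) + 2 * ((k + 1 : ℕ) : ℝ) * h = hartleyFreq m k * t + h := by
      rw [hartleyFreq, hh]
      push_cast
      field_simp
      ring
    have e2 : -(π * t) + 2 * (k : ℝ) * h = hartleyFreq m k * t - h := by
      rw [hartleyFreq, hh]
      field_simp
      ring
    rw [e1, e2, Real.sin_add, Real.sin_sub]
    ring
  have hsum : 2 * Real.sin h * ∑ k ∈ Finset.range (2 * m), Real.cos (hartleyFreq m k * t) = 0 := by
    rw [Finset.mul_sum, Finset.sum_congr rfl fun k _ => htel k,
      Finset.sum_range_sub (fun k : ℕ => Real.sin (-(π * t) + 2 * (k : ℝ) * h))]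
    have e3 : -(π * t) + 2 * ((2 * m : ℕ) : ℝ) * h = t * π := by
      rw [hh]
      push_cast
      field_simp
      ring
    have e4 : -(π * t) + 2 * ((0 : ℕ) : ℝ) * h = -(t * π) := by simp [mul_comm]
    rw [e3, e4, Real.sin_neg, Real.sin_int_mul_pi]
    simp
  have : (2 : ℝ) * Real.sin h ≠ 0 := by simpa using hsin
  exact (mul_eq_zero.1 hsum).resolve_left this

/-- The half-integer shift makes the phase an odd multiple of `π`. This is the origin of the minus
signs in `skewCirculant`. -/
lemma cos_hartleyFreq_two_mul {m : ℕ} (hm : 0 < m) (k : ℕ) :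
    Real.cos (hartleyFreq m k * (2 * m)) = -1 := by
  have hm0 : (m : ℝ) ≠ 0 := by positivity
  have : hartleyFreq m k * (2 * m) = ((k : ℤ) - m : ℤ) * (2 * π) + π := by
    rw [hartleyFreq]
    push_cast
    field_simp
    ring
  rw [this, Real.cos_add_pi, Real.cos_int_mul_two_pi]

lemma sum_cos_hartleyFreq {m : ℕ} (hm : 0 < m) {t : ℤ} (ht : |t| < 4 * m) :
    ∑ k ∈ Finset.range (2 * m), Real.cos (hartleyFreq m k * t) =
      2 * m * ((if t = 0 then 1 else 0) - (if t = 2 * m then 1 else 0)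
        - (if t = -(2 * m) then 1 else 0)) := by
  by_cases hd : (2 * m : ℤ) ∣ t
  · obtain ⟨q, rfl⟩ := hd
    have hm' : (0 : ℤ) < m := by exact_mod_cast hm
    have hq : |q| < 2 := by
      rw [abs_mul, abs_of_pos (by positivity : (0 : ℤ) < 2 * m)] at ht
      by_contra! h
      nlinarith
    rw [abs_lt] at hq
    have hq' : q = 0 ∨ q = 1 ∨ q = -1 := by omega
    have hm2 : (m : ℤ) ≠ 0 := hm'.ne'
    rcases hq' with rfl | rfl | rfl
    · simp [hm.ne', Eq.comm]
    · have h1 : (2 * m * 1 : ℤ) ≠ 0 := by omega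
      have h2 : (2 * m * 1 : ℤ) ≠ -(2 * m) := by omega
      rw [if_neg h1, if_pos (by ring), if_neg h2]
      have : ∀ k ∈ Finset.range (2 * m),
          Real.cos (hartleyFreq m k * ((2 * m * 1 : ℤ) : ℝ)) = -1 := by
        intro k _
        rw [← cos_hartleyFreq_two_mul hm k]
        push_cast
        simp
      rw [Finset.sum_congr rfl this]
      simp
    · have h1 : (2 * m * (-1) : ℤ) ≠ 0 := by omega
      have h2 : (2 * m * (-1) : ℤ) ≠ 2 * m := by omega
      rw [if_neg h1, if_neg h2, if_pos (by ring)]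
      have : ∀ k ∈ Finset.range (2 * m),
          Real.cos (hartleyFreq m k * ((2 * m * (-1) : ℤ) : ℝ)) = -1 := by
        intro k _
        rw [← cos_hartleyFreq_two_mul hm k, ← Real.cos_neg]
        push_cast
        simp
      rw [Finset.sum_congr rfl this]
      simp
  · rw [sum_cos_hartleyFreq_of_not_dvd hm hd, if_neg, if_neg, if_neg]
    · simp
    · rintro rfl; exact hd (by simp)
    · rintro rfl; exact hd (by simp)
    · rintro rfl; exact hd (by simp)

/-- The matrix of the Hartley transform. -/
def hartley (m : ℕ) : Matrix (Fin m ⊕ Fin m) (Fin (2 * m)) ℝ :=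
  Matrix.of fun k x => (√(2 * m))⁻¹ *
    (Real.cos (hartleyFreq m (hartleyLabel m k) * (x : ℕ))
      + Real.sin (hartleyFreq m (hartleyLabel m k) * (x : ℕ)))

/-- The truncated Fourier series `∑_{|d| < m} g(d) cos(d ω)`. -/
def cosSum (g : ℤ → ℝ) (m : ℕ) (ω : ℝ) : ℝ :=
  ∑ d ∈ Finset.Ioo (-(m : ℤ)) m, g d * Real.cos (ω * d)

/-- The skew-circulant matrix with symbol `cosSum g m`. -/
def skewCirculant (g : ℤ → ℝ) (m : ℕ) : Matrix (Fin (2 * m)) (Fin (2 * m)) ℝ :=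
  Matrix.of fun x y =>
    (if |((x : ℕ) : ℤ) - (y : ℕ)| < m then g ((x : ℕ) - (y : ℕ)) else 0)
    - (if (m : ℤ) < (x : ℕ) - (y : ℕ) then g ((x : ℕ) - (y : ℕ) - 2 * m) else 0)
    - (if ((x : ℕ) : ℤ) - (y : ℕ) < -m then g ((x : ℕ) - (y : ℕ) + 2 * m) else 0)

lemma sum_Ioo_neg {g : ℤ → ℝ} (m : ℕ) :
    ∑ d ∈ Finset.Ioo (-(m : ℤ)) m, g (-d) = ∑ d ∈ Finset.Ioo (-(m : ℤ)) m, g d :=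
  Finset.sum_nbij' (fun d => -d) (fun d => -d) (by simp; omega) (by simp; omega)
    (by simp) (by simp) (by simp)

/-- Discrete orthogonality: the product of cosines splits into lags `d - D` and `d + D`, which
contribute equally because `g` is even. Only `d = D` and its aliases `D ± 2 * m` survive, the
aliases with sign `-1`. -/
lemma sum_cosSum_mul_cos {g : ℤ → ℝ} (hg : ∀ d, g (-d) = g d) {m : ℕ} (hm : 0 < m) {D : ℤ}
    (hD : |D| < 2 * m) :
    ∑ k ∈ Finset.range (2 * m), cosSum g m (hartleyFreq m k) * Real.cos (hartleyFreq m k * D) =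
      2 * m * ((if |D| < m then g D else 0) - (if (m : ℤ) < D then g (D - 2 * m) else 0)
        - (if D < -m then g (D + 2 * m) else 0)) := by
  set S : ℤ → ℝ := fun t => ∑ k ∈ Finset.range (2 * m), Real.cos (hartleyFreq m k * t) with hS
  have h1 : ∑ k ∈ Finset.range (2 * m),
      cosSum g m (hartleyFreq m k) * Real.cos (hartleyFreq m k * D) =
      ∑ d ∈ Finset.Ioo (-(m : ℤ)) m, g d * ((S (d - D) + S (d + D)) / 2) := by
    simp only [cosSum, Finset.sum_mul, hS]
    rw [Finset.sum_comm]
    refine Finset.sum_congr rfl fun d _ => ?_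
    rw [← Finset.sum_add_distrib, Finset.sum_div, Finset.mul_sum]
    refine Finset.sum_congr rfl fun k _ => ?_
    push_cast
    rw [mul_sub, mul_add, Real.cos_sub, Real.cos_add]
    ring
  have hSneg : ∀ t, S (-t) = S t := by
    intro t
    simp only [hS]
    refine Finset.sum_congr rfl fun k _ => ?_
    push_cast
    rw [mul_neg, Real.cos_neg]
  have h2 : ∑ d ∈ Finset.Ioo (-(m : ℤ)) m, g d * S (d + D) =
      ∑ d ∈ Finset.Ioo (-(m : ℤ)) m, g d * S (d - D) := by
    rw [← sum_Ioo_neg]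
    refine Finset.sum_congr rfl fun d _ => ?_
    rw [hg, ← hSneg]
    congr 2
    ring
  have h3 : ∑ d ∈ Finset.Ioo (-(m : ℤ)) m, g d * ((S (d - D) + S (d + D)) / 2) =
      ∑ d ∈ Finset.Ioo (-(m : ℤ)) m, g d * S (d - D) := by
    have : ∀ d, g d * ((S (d - D) + S (d + D)) / 2) =
        (g d * S (d - D) + g d * S (d + D)) / 2 := fun d => by ring
    simp only [this]
    rw [← Finset.sum_div, Finset.sum_add_distrib, h2]
    ring
  rw [h1, h3]
  have h4 : ∀ d ∈ Finset.Ioo (-(m : ℤ)) m, g d * S (d - D) = 2 * m *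
      ((if d = D then g d else 0) - (if d = D + 2 * m then g d else 0)
        - (if d = D - 2 * m then g d else 0)) := by
    intro d hd
    rw [Finset.mem_Ioo] at hd
    have hlt : |d - D| < 4 * m := by
      rw [abs_lt] at hD ⊢
      omega
    simp only [hS]
    rw [sum_cos_hartleyFreq hm hlt]
    have e1 : (d - D = 0) = (d = D) := by apply propext; omega
    have e2 : (d - D = 2 * m) = (d = D + 2 * m) := by apply propext; omega
    have e3 : (d - D = -(2 * m)) = (d = D - 2 * m) := by apply propext; omega
    simp only [e1, e2, e3]
    split_ifs <;> ring
  rw [Finset.sum_congr rfl h4, ← Finset.mul_sum, Finset.sum_sub_distrib, Finset.sum_sub_distrib,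
    Finset.sum_ite_eq', Finset.sum_ite_eq', Finset.sum_ite_eq']
  rw [abs_lt] at hD
  have e1 : (D ∈ Finset.Ioo (-(m : ℤ)) m) = (|D| < m) := by
    rw [Finset.mem_Ioo, abs_lt]
  have e2 : (D + 2 * m ∈ Finset.Ioo (-(m : ℤ)) m) = (D < -m) := by
    rw [Finset.mem_Ioo]; apply propext; omega
  have e3 : (D - 2 * m ∈ Finset.Ioo (-(m : ℤ)) m) = ((m : ℤ) < D) := by
    rw [Finset.mem_Ioo]; apply propext; omega
  simp only [e1, e2, e3]
  ring

/-- The Hartley transform diagonalizes skew-circulant matrices. -/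
lemma hartley_transpose_mul_diagonal_mul {g : ℤ → ℝ} (hg : ∀ d, g (-d) = g d) {m : ℕ}
    (hm : 0 < m) :
    (hartley m).transpose * Matrix.diagonal
      (fun k => cosSum g m (hartleyFreq m (hartleyLabel m k))) * hartley m =
      skewCirculant g m := by
  ext x y
  have hm0 : (0 : ℝ) < 2 * m := by positivity
  rw [Matrix.mul_apply]
  simp only [Matrix.mul_diagonal, Matrix.transpose_apply, hartley, Matrix.of_apply]
  rw [sum_hartleyLabel m (fun k => (√(2 * m))⁻¹ * (Real.cos (hartleyFreq m k * (x : ℕ))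
      + Real.sin (hartleyFreq m k * (x : ℕ))) * cosSum g m (hartleyFreq m k) *
      ((√(2 * m))⁻¹ * (Real.cos (hartleyFreq m k * (y : ℕ))
      + Real.sin (hartleyFreq m k * (y : ℕ)))))]
  have h1 : ∀ k, (√(2 * m))⁻¹ * (Real.cos (hartleyFreq m k * (x : ℕ))
      + Real.sin (hartleyFreq m k * (x : ℕ))) * cosSum g m (hartleyFreq m k) *
      ((√(2 * m))⁻¹ * (Real.cos (hartleyFreq m k * (y : ℕ))
      + Real.sin (hartleyFreq m k * (y : ℕ)))) =
      (2 * m : ℝ)⁻¹ * (cosSum g m (hartleyFreq m k) *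
        Real.cos (hartleyFreq m k * (((x : ℕ) - (y : ℕ) : ℤ) : ℝ)) +
      cosSum g m (hartleyFreq m k) * Real.sin (hartleyFreq m k * ((x : ℕ) + (y : ℕ)))) := by
    intro k
    have hsq : (√(2 * m : ℝ))⁻¹ * (√(2 * m : ℝ))⁻¹ = (2 * m : ℝ)⁻¹ := by
      rw [← mul_inv, Real.mul_self_sqrt hm0.le]
    rw [← hsq]
    push_cast
    rw [mul_sub, mul_add (hartleyFreq m k), Real.cos_sub, Real.sin_add]
    ring
  have hDlt : |((x : ℕ) : ℤ) - (y : ℕ)| < 2 * m := by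
    have := x.2; have := y.2
    rw [abs_lt]
    omega
  -- Since `(cos a + sin a) * (cos b + sin b) = cos (a - b) + sin (a + b)`, evenness of the symbol
  -- removes the part depending on `x + y`.
  have hsin := sum_mul_sin_hartleyFreq m (fun k => cosSum g m (hartleyFreq m k))
    (fun k hk => by
      simp only [cosSum, hartleyFreq_reflect hk, neg_mul, Real.cos_neg]) ((x : ℕ) + (y : ℕ))
  simp only [h1]
  rw [← Finset.mul_sum, Finset.sum_add_distrib, hsin, add_zero, sum_cosSum_mul_cos hg hm hDlt,
    inv_mul_cancel_left₀ hm0.ne']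
  rfl

/-- The sequence concentrated at lag `0` has constant symbol `1`, and its skew-circulant matrix is
the identity. -/
lemma hartley_transpose_mul_hartley {m : ℕ} (hm : 0 < m) :
    (hartley m).transpose * hartley m = 1 := by
  have hg : ∀ d : ℤ, (if -d = 0 then (1 : ℝ) else 0) = if d = 0 then 1 else 0 := by simp
  have h := hartley_transpose_mul_diagonal_mul (g := fun d => if d = 0 then 1 else 0) hg hm
  have h1 : ∀ ω, cosSum (fun d => if d = 0 then 1 else 0) m ω = 1 := by
    intro ω
    simp [cosSum, hm]
  simp only [h1, Matrix.diagonal_one, Matrix.mul_one] at h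
  rw [h]
  ext x y
  rw [skewCirculant, Matrix.of_apply, Matrix.one_apply]
  have := x.2; have := y.2
  by_cases hxy : x = y
  · subst hxy
    have h1 : ¬ (m : ℤ) < 0 := by omega
    simp [hm, h1]
  · have hne : (x : ℕ) ≠ y := fun h => hxy (Fin.ext h)
    rw [if_neg hxy]
    have h1 : ((x : ℕ) : ℤ) - (y : ℕ) ≠ 0 := by omega
    have h2 : ((x : ℕ) : ℤ) - (y : ℕ) - 2 * m ≠ 0 := by omega
    have h3 : ((x : ℕ) : ℤ) - (y : ℕ) + 2 * m ≠ 0 := by omega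
    simp [h1, h2, h3]

lemma hartley_mul_hartley_transpose {m : ℕ} (hm : 0 < m) :
    hartley m * (hartley m).transpose = 1 := by
  have e : Fin m ⊕ Fin m ≃ Fin (2 * m) := finSumFinEquiv.trans (finCongr (by ring))
  exact (Matrix.mul_eq_one_comm_of_equiv e).2 (hartley_transpose_mul_hartley hm)

/-- The skew-circulant matrix in the Hartley basis. -/
lemma hartley_mul_skewCirculant_mul {g : ℤ → ℝ} (hg : ∀ d, g (-d) = g d) {m : ℕ}
    (hm : 0 < m) :
    hartley m * skewCirculant g m * (hartley m).transpose =
      Matrix.diagonal (fun k => cosSum g m (hartleyFreq m (hartleyLabel m k))) := by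
  rw [← hartley_transpose_mul_diagonal_mul hg hm]
  have h := hartley_mul_hartley_transpose hm
  calc _ = (hartley m * (hartley m).transpose) * Matrix.diagonal
        (fun k => cosSum g m (hartleyFreq m (hartleyLabel m k))) *
        (hartley m * (hartley m).transpose) := by simp only [Matrix.mul_assoc]
    _ = _ := by rw [h, Matrix.one_mul, Matrix.mul_one]

/-! ### Overlap-add: from a stationary to a skew-periodic covariance -/

/-- The window angle, increasing from `0` to `π / 2` over a stretch of length `r`. -/
def windowAngle (r j : ℕ) : ℝ := π / 2 * min ((j : ℝ) / r) 1

lemma windowAngle_nonneg (r j : ℕ) : 0 ≤ windowAngle r j := by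
  unfold windowAngle; positivity

lemma windowAngle_le (r j : ℕ) : windowAngle r j ≤ π / 2 :=
  mul_le_of_le_one_right (by positivity) (min_le_right _ _)

lemma windowAngle_of_le {r j : ℕ} (hr : 0 < r) (h : r ≤ j) : windowAngle r j = π / 2 := by
  have : (1 : ℝ) ≤ (j : ℝ) / r := by
    rw [one_le_div (by positivity)]
    exact_mod_cast h
  rw [windowAngle, min_eq_right this, mul_one]

lemma windowAngle_le_mul (r j : ℕ) : windowAngle r j ≤ π / 2 * ((j : ℝ) / r) :=
  mul_le_mul_of_nonneg_left (min_le_left _ _) (by positivity)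

lemma abs_windowAngle_sub_le (r k d : ℕ) :
    |windowAngle r (k + d) - windowAngle r k| ≤ π / 2 * ((d : ℝ) / r) := by
  have hd : (0 : ℝ) ≤ (d : ℝ) / r := by positivity
  have e : ((k + d : ℕ) : ℝ) / r = (k : ℝ) / r + (d : ℝ) / r := by push_cast; ring
  have h1 : min ((k : ℝ) / r) 1 ≤ min ((k : ℝ) / r + (d : ℝ) / r) 1 :=
    min_le_min_right _ (by linarith)
  have h2 : min ((k : ℝ) / r + (d : ℝ) / r) 1 ≤ min ((k : ℝ) / r) 1 + (d : ℝ) / r := by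
    rcases le_total ((k : ℝ) / r) 1 with h | h
    · rw [min_eq_left h]; exact min_le_left _ _
    · rw [min_eq_right h]; exact (min_le_right _ _).trans (by linarith)
  rw [windowAngle, windowAngle, e, ← mul_sub, abs_mul, abs_of_nonneg (by positivity : 0 ≤ π / 2)]
  refine mul_le_mul_of_nonneg_left ?_ (by positivity)
  rw [abs_of_nonneg (by linarith)]
  linarith

/-- For `t ≤ 1` the quadratic bound on `1 - cos` gives `4 * t ^ 2 ≤ 4 * t ^ p`; for `t ≥ 1` the left
side is at most `1`, the cosine being nonnegative. -/
lemma one_sub_cos_sq_le {x t p : ℝ} (hp : p ≤ 2) (hp0 : 0 < p) (ht : 0 ≤ t)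
    (hx : |x| ≤ π / 2 * t) (hx2 : |x| ≤ π / 2) : (1 - Real.cos x) ^ 2 ≤ 4 * t ^ p := by
  have hc0 : 0 ≤ Real.cos x := by
    rw [← Real.cos_abs]
    exact Real.cos_nonneg_of_neg_pi_div_two_le_of_le (by linarith [abs_nonneg x, Real.pi_pos]) hx2
  have hc1 := Real.cos_le_one x
  rcases le_total t 1 with h | h
  · have h1 := Real.one_sub_sq_div_two_le_cos (x := x)
    have hpi : π ≤ 4 := Real.pi_le_four
    have h2 : x ^ 2 ≤ 4 * t ^ 2 := by
      rw [← sq_abs]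
      have : |x| ≤ 2 * t := hx.trans (mul_le_mul_of_nonneg_right (by linarith) ht)
      nlinarith [abs_nonneg x]
    have h3 : (1 - Real.cos x) ^ 2 ≤ 4 * t ^ 2 := by
      have : 1 - Real.cos x ≤ 2 * t ^ 2 := by linarith
      have h4 : (1 - Real.cos x) ^ 2 ≤ (2 * t ^ 2) ^ 2 := pow_le_pow_left₀ (by linarith) this 2
      have h5 : t ^ 2 ≤ 1 := pow_le_one₀ ht h
      nlinarith [sq_nonneg t]
    refine h3.trans (mul_le_mul_of_nonneg_left ?_ (by norm_num))
    rcases ht.eq_or_lt with h0 | h0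
    · rw [← h0, Real.zero_rpow hp0.ne']; norm_num
    · rw [← Real.rpow_two]
      exact Real.rpow_le_rpow_of_exponent_ge h0 h hp
  · have := Real.one_le_rpow h hp0.le
    nlinarith

/-- The overlap-add matrix: `z_j = sin θ_j y_j - cos θ_j y_{j + 2m}`. -/
def overlapAdd (m r n : ℕ) : Matrix (Fin (2 * m)) (Fin n) ℝ :=
  Matrix.of fun j i => (if (i : ℕ) = j then Real.sin (windowAngle r j) else 0)
    - (if (i : ℕ) = j + 2 * m then Real.cos (windowAngle r j) else 0)

/-- There is no boundary case: `j + 2 * m` leaves the sample only when `j ≥ r`, and there the cosine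
weight is zero. -/
lemma sum_overlapAdd_mul {m r n : ℕ} (hr : 0 < r) (hn : 2 * m + r = n) (j : Fin (2 * m))
    (h : ℕ → ℝ) :
    ∑ i : Fin n, overlapAdd m r n j i * h i =
      Real.sin (windowAngle r j) * h j - Real.cos (windowAngle r j) * h (j + 2 * m) := by
  simp only [overlapAdd, Matrix.of_apply, sub_mul, ite_mul, zero_mul]
  rw [Finset.sum_sub_distrib,
    Fin.sum_univ_eq_sum_range
      (fun i => if i = (j : ℕ) then Real.sin (windowAngle r j) * h i else 0),
    Fin.sum_univ_eq_sum_range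
      (fun i => if i = (j : ℕ) + 2 * m then Real.cos (windowAngle r j) * h i else 0),
    Finset.sum_ite_eq', Finset.sum_ite_eq', if_pos (Finset.mem_range.2 (by have := j.2; omega))]
  split_ifs with hj
  · rfl
  · rw [Finset.mem_range, not_lt] at hj
    rw [windowAngle_of_le hr (by omega : r ≤ (j : ℕ)), Real.cos_pi_div_two]
    ring

lemma overlapAdd_mul_toeplitz_mul {m r n : ℕ} (hr : 0 < r) (hn : 2 * m + r = n) {g : ℤ → ℝ}
    (hg : ∀ d, g (-d) = g d) (j k : Fin (2 * m)) :
    (overlapAdd m r n * Matrix.of (fun i i' : Fin n => g ((i' : ℤ) - (i : ℤ))) *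
      (overlapAdd m r n).transpose) j k =
      Real.cos (windowAngle r j - windowAngle r k) * g ((j : ℕ) - (k : ℕ))
        - Real.sin (windowAngle r j) * Real.cos (windowAngle r k) * g ((j : ℕ) - (k : ℕ) - 2 * m)
        - Real.cos (windowAngle r j) * Real.sin (windowAngle r k) *
          g ((j : ℕ) - (k : ℕ) + 2 * m) := by
  rw [Matrix.mul_apply]
  simp only [Matrix.mul_apply, Matrix.of_apply, Matrix.transpose_apply]
  have h1 : ∀ i' : Fin n, ∑ i : Fin n, overlapAdd m r n j i * g ((i' : ℤ) - (i : ℤ)) =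
      Real.sin (windowAngle r j) * g ((i' : ℤ) - (j : ℕ))
        - Real.cos (windowAngle r j) * g ((i' : ℤ) - ((j : ℕ) + 2 * m : ℕ)) := fun i' =>
    sum_overlapAdd_mul hr hn j (fun i => g ((i' : ℤ) - (i : ℤ)))
  simp only [h1]
  simp only [mul_comm _ (overlapAdd m r n k _)]
  rw [sum_overlapAdd_mul hr hn k (fun i' => Real.sin (windowAngle r j) * g ((i' : ℤ) - (j : ℕ))
        - Real.cos (windowAngle r j) * g ((i' : ℤ) - ((j : ℕ) + 2 * m : ℕ)))]
  push_cast
  have e1 : g (((k : ℕ) : ℤ) - (j : ℕ)) = g ((j : ℕ) - (k : ℕ)) := by rw [← hg]; congr 1; ring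
  have e2 : g (((k : ℕ) : ℤ) - ((j : ℕ) + 2 * m)) = g ((j : ℕ) - (k : ℕ) + 2 * m) := by
    rw [← hg]; congr 1; ring
  have e3 : g (((k : ℕ) : ℤ) + 2 * m - (j : ℕ)) = g ((j : ℕ) - (k : ℕ) - 2 * m) := by
    rw [← hg]; congr 1; ring
  have e4 : g (((k : ℕ) : ℤ) + 2 * m - ((j : ℕ) + 2 * m)) = g ((j : ℕ) - (k : ℕ)) := by
    rw [← hg]; congr 1; ring
  rw [e1, e2, e3, e4, Real.cos_sub]
  ring

/-- The entries of the difference between the overlap-add covariance and the skew-circulant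
covariance. -/
def overlapError (g : ℤ → ℝ) (m r j k : ℕ) : ℝ :=
  Real.cos (windowAngle r j - windowAngle r k) * g (j - k)
    - Real.sin (windowAngle r j) * Real.cos (windowAngle r k) * g (j - k - 2 * m)
    - Real.cos (windowAngle r j) * Real.sin (windowAngle r k) * g (j - k + 2 * m)
    - ((if |(j : ℤ) - k| < m then g (j - k) else 0)
      - (if (m : ℤ) < j - k then g (j - k - 2 * m) else 0)
      - (if (j : ℤ) - k < -m then g (j - k + 2 * m) else 0))

lemma overlapError_comm {g : ℤ → ℝ} (hg : ∀ d, g (-d) = g d) (m r j k : ℕ) :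
    overlapError g m r j k = overlapError g m r k j := by
  unfold overlapError
  have e1 : g ((j : ℤ) - k) = g (k - j) := by rw [← hg]; congr 1; ring
  have e2 : g ((j : ℤ) - k - 2 * m) = g (k - j + 2 * m) := by rw [← hg]; congr 1; ring
  have e3 : g ((j : ℤ) - k + 2 * m) = g (k - j - 2 * m) := by rw [← hg]; congr 1; ring
  have e4 : Real.cos (windowAngle r j - windowAngle r k) =
      Real.cos (windowAngle r k - windowAngle r j) := by rw [← Real.cos_neg]; congr 1; ring
  have e5 : ((m : ℤ) < j - k) = ((k : ℤ) - j < -m) := by apply propext; omega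
  have e6 : ((j : ℤ) - k < -m) = ((m : ℤ) < k - j) := by apply propext; omega
  simp only [e1, e2, e3, e4, e5, e6, abs_sub_comm (j : ℤ) k]
  ring

/-- A bound for the squared coefficients of `overlapError`. -/
def overlapWeight (p : ℝ) (r k e : ℕ) : ℝ :=
  4 * (if k < r then ((e : ℝ) / r) ^ p else 0) + (if r ≤ k ∧ k < e then 1 else 0)

lemma overlapWeight_nonneg (p : ℝ) (r k e : ℕ) : 0 ≤ overlapWeight p r k e := by
  unfold overlapWeight; positivity

/-- At most `r` positions carry `4 * (e / r) ^ p`. The second part is nonzero only if `r < e`; it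
counts at most `e` positions, and `e ≤ r ^ (1 - p) * e ^ p` because `p ≥ 1`. -/
lemma sum_overlapWeight_le {p : ℝ} (hp1 : 1 ≤ p) {r : ℕ} (hr : 0 < r) (N e : ℕ) :
    ∑ k ∈ Finset.range N, overlapWeight p r k e ≤ 5 * (r : ℝ) ^ (1 - p) * (e : ℝ) ^ p := by
  have hr0 : (0 : ℝ) < r := by exact_mod_cast hr
  have hrp : (r : ℝ) ^ (1 - p) = r / (r : ℝ) ^ p := by
    rw [Real.rpow_sub hr0, Real.rpow_one]
  unfold overlapWeight
  rw [Finset.sum_add_distrib, ← Finset.mul_sum]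
  have h1 : ∑ k ∈ Finset.range N, (if k < r then ((e : ℝ) / r) ^ p else 0) ≤
      (r : ℝ) ^ (1 - p) * (e : ℝ) ^ p := by
    rw [← Finset.sum_filter, Finset.sum_const, nsmul_eq_mul,
      Real.div_rpow (by positivity) hr0.le, hrp]
    have hcard : ((Finset.range N).filter (· < r)).card ≤ r := by
      calc _ ≤ (Finset.range r).card := Finset.card_le_card fun k hk => by
            simp at hk ⊢; exact hk.2
        _ = r := Finset.card_range r
    calc _ ≤ (r : ℝ) * ((e : ℝ) ^ p / (r : ℝ) ^ p) :=
          mul_le_mul_of_nonneg_right (by exact_mod_cast hcard) (by positivity)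
      _ = _ := by ring
  have h2 : ∑ k ∈ Finset.range N, (if r ≤ k ∧ k < e then (1 : ℝ) else 0) ≤
      (r : ℝ) ^ (1 - p) * (e : ℝ) ^ p := by
    rcases lt_or_ge r e with hre | hre
    · have he0 : (0 : ℝ) < e := by exact_mod_cast hr.trans hre
      have hcard : ((Finset.range N).filter (fun k => r ≤ k ∧ k < e)).card ≤ e := by
        calc _ ≤ (Finset.range e).card := Finset.card_le_card fun k hk => by
              simp at hk ⊢; exact hk.2.2
          _ = e := Finset.card_range e
      rw [← Finset.sum_filter, Finset.sum_const, nsmul_eq_mul, mul_one]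
      refine le_trans (by exact_mod_cast hcard : _ ≤ (e : ℝ)) ?_
      have h3 : (e : ℝ) ^ (1 - p) ≤ (r : ℝ) ^ (1 - p) :=
        Real.rpow_le_rpow_of_nonpos hr0 (by exact_mod_cast hre.le) (by linarith)
      calc (e : ℝ) = (e : ℝ) ^ (1 - p) * (e : ℝ) ^ p := by
            rw [← Real.rpow_add he0]; simp
        _ ≤ _ := mul_le_mul_of_nonneg_right h3 (by positivity)
    · rw [Finset.sum_eq_zero]
      · positivity
      · intro k _
        rw [if_neg]
        omega
  linarith

/-- The error is a combination of `g` at the lags `d`, `2 * m - d` and `2 * m + d`. Inside the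
window the angles vary slowly; beyond it they equal `π / 2`, which makes most coefficients exact.
The term `(d / m) ^ p` pays for cutting off the lags `d ≥ m`. -/
lemma overlapError_sq_le {g : ℤ → ℝ} (hg : ∀ d, g (-d) = g d) {p : ℝ} (hp1 : 1 ≤ p) (hp2 : p ≤ 2)
    {m r : ℕ} (hr : 0 < r) (hrm : r ≤ m) {k d : ℕ} (hkd : k + d < 2 * m) :
    overlapError g m r (k + d) k ^ 2 ≤
      3 * ((overlapWeight p r k d + ((d : ℝ) / m) ^ p) * g d ^ 2
        + overlapWeight p r k (2 * m - d) * g (2 * m - d : ℕ) ^ 2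
        + overlapWeight p r k (2 * m + d) * g (2 * m + d : ℕ) ^ 2) := by
  have hr0 : (0 : ℝ) < r := by exact_mod_cast hr
  have hm0 : (0 : ℝ) < m := by exact_mod_cast hr.trans_le hrm
  have hp0 : 0 < p := by linarith
  set c₁ : ℝ := Real.cos (windowAngle r (k + d) - windowAngle r k) - (if d < m then 1 else 0)
    with hc₁
  set c₂ : ℝ := (if m < d then 1 else 0) -
    Real.sin (windowAngle r (k + d)) * Real.cos (windowAngle r k) with hc₂
  set c₃ : ℝ := Real.cos (windowAngle r (k + d)) * Real.sin (windowAngle r k) with hc₃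
  have hE : overlapError g m r (k + d) k =
      c₁ * g d + c₂ * g (2 * m - d : ℕ) - c₃ * g (2 * m + d : ℕ) := by
    unfold overlapError
    have e0 : ((k + d : ℕ) : ℤ) - k = d := by push_cast; ring
    have e1 : g ((d : ℤ) - 2 * m) = g (2 * m - d : ℕ) := by
      rw [← hg]; congr 1; omega
    have e2 : g ((d : ℤ) + 2 * m) = g (2 * m + d : ℕ) := by
      congr 1; push_cast; ring
    have e3 : (|(d : ℤ)| < m) = (d < m) := by simp
    have e4 : ((m : ℤ) < d) = (m < d) := by simp
    have e5 : ¬ ((d : ℤ) < -m) := by omega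
    simp only [e0, e1, e2, e3, e4, if_neg e5, hc₁, hc₂, hc₃]
    split_ifs <;> ring
  have habs : |windowAngle r (k + d) - windowAngle r k| ≤ π / 2 := by
    rw [abs_le]
    constructor <;> linarith [windowAngle_nonneg r (k + d), windowAngle_le r (k + d),
      windowAngle_nonneg r k, windowAngle_le r k]
  -- At lags of at least `r` the weight is at least `1` inside the window, so the trivial bound on
  -- sines and cosines suffices.
  have hge : ∀ {e : ℕ}, r ≤ e → (1 : ℝ) ≤ ((e : ℝ) / r) ^ p := fun {e} he =>
    Real.one_le_rpow (by rw [one_le_div hr0]; exact_mod_cast he) hp0.le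
  have b₁ : c₁ ^ 2 ≤ overlapWeight p r k d + ((d : ℝ) / m) ^ p := by
    rw [hc₁]
    have hpos : 0 ≤ ((d : ℝ) / m) ^ p := by positivity
    by_cases hdm : d < m
    · rw [if_pos hdm]
      by_cases hk : k < r
      · have h := one_sub_cos_sq_le hp2 hp0 (by positivity) (abs_windowAngle_sub_le r k d) habs
        have hw : 4 * ((d : ℝ) / r) ^ p ≤ overlapWeight p r k d := by
          unfold overlapWeight; rw [if_pos hk]
          have : (0 : ℝ) ≤ (if r ≤ k ∧ k < d then 1 else 0) := by positivity
          linarith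
        nlinarith
      · rw [windowAngle_of_le hr (by omega : r ≤ k), windowAngle_of_le hr (by omega : r ≤ k + d)]
        simp only [sub_self, Real.cos_zero]
        have := overlapWeight_nonneg p r k d
        simp only [ne_eq, OfNat.ofNat_ne_zero, not_false_eq_true, zero_pow]
        linarith
    · rw [if_neg hdm, sub_zero]
      have h1 : (1 : ℝ) ≤ ((d : ℝ) / m) ^ p :=
        Real.one_le_rpow (by rw [one_le_div hm0]; exact_mod_cast not_lt.1 hdm) hp0.le
      have := overlapWeight_nonneg p r k d
      have := Real.cos_sq_le_one (windowAngle r (k + d) - windowAngle r k)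
      linarith
  have b₂ : c₂ ^ 2 ≤ overlapWeight p r k (2 * m - d) := by
    rw [hc₂]
    -- For `m < d` the wrapped lag should have coefficient `1`. Then `k + d ≥ r` makes the sine `1`,
    -- and `k < 2 * m - d` bounds the angle at `k` by the lag. For `d ≤ m` the lag `2 * m - d` is at
    -- least `r`.
    by_cases hdm : m < d
    · rw [if_pos hdm, windowAngle_of_le hr (by omega : r ≤ k + d), Real.sin_pi_div_two, one_mul]
      by_cases hk : k < r
      · have hke : ((k : ℝ) / r) ≤ ((2 * m - d : ℕ) : ℝ) / r := by
          gcongr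
          omega
        have h := one_sub_cos_sq_le (x := windowAngle r k)
          (t := ((2 * m - d : ℕ) : ℝ) / r) hp2 hp0 (by positivity)
          (by
            rw [abs_of_nonneg (windowAngle_nonneg r k)]
            exact (windowAngle_le_mul r k).trans (mul_le_mul_of_nonneg_left hke (by positivity)))
          (by rw [abs_of_nonneg (windowAngle_nonneg r k)]; exact windowAngle_le r k)
        refine h.trans ?_
        unfold overlapWeight; rw [if_pos hk]
        have : (0 : ℝ) ≤ (if r ≤ k ∧ k < 2 * m - d then 1 else 0) := by positivity
        linarith
      · rw [windowAngle_of_le hr (by omega : r ≤ k), Real.cos_pi_div_two]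
        unfold overlapWeight
        rw [if_neg hk, if_pos (by omega)]
        norm_num
    · rw [if_neg hdm, zero_sub, neg_sq]
      by_cases hk : k < r
      · have h1 := hge (e := 2 * m - d) (by omega)
        have hw : 1 ≤ overlapWeight p r k (2 * m - d) := by
          unfold overlapWeight; rw [if_pos hk]
          have : (0 : ℝ) ≤ (if r ≤ k ∧ k < 2 * m - d then 1 else 0) := by positivity
          linarith
        refine le_trans ?_ hw
        rw [mul_pow]
        exact mul_le_one₀ (Real.sin_sq_le_one _) (sq_nonneg _) (Real.cos_sq_le_one _)
      · rw [windowAngle_of_le hr (by omega : r ≤ k), Real.cos_pi_div_two]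
        simpa using overlapWeight_nonneg p r k (2 * m - d)
  have b₃ : c₃ ^ 2 ≤ overlapWeight p r k (2 * m + d) := by
    rw [hc₃]
    by_cases hk : k < r
    · have h1 := hge (e := 2 * m + d) (by omega)
      have hw : 1 ≤ overlapWeight p r k (2 * m + d) := by
        unfold overlapWeight; rw [if_pos hk]
        have : (0 : ℝ) ≤ (if r ≤ k ∧ k < 2 * m + d then 1 else 0) := by positivity
        linarith
      refine le_trans ?_ hw
      rw [mul_pow]
      exact mul_le_one₀ (Real.cos_sq_le_one _) (sq_nonneg _) (Real.sin_sq_le_one _)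
    · rw [windowAngle_of_le hr (by omega : r ≤ k + d), Real.cos_pi_div_two]
      simpa using overlapWeight_nonneg p r k (2 * m + d)
  have hsq : ∀ x y z : ℝ, (x + y - z) ^ 2 ≤ 3 * (x ^ 2 + y ^ 2 + z ^ 2) := fun x y z => by
    nlinarith [sq_nonneg (x - y), sq_nonneg (x + z), sq_nonneg (y + z)]
  rw [hE]
  refine (hsq _ _ _).trans (mul_le_mul_of_nonneg_left ?_ (by norm_num))
  simp only [mul_pow]
  gcongr

/-- By symmetry the triangle `k ≤ j` counted twice dominates the square; there `j = k + d` is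
parametrized by position and lag. -/
lemma sum_range_sum_range_le {N : ℕ} {F G : ℕ → ℕ → ℝ} (hF : ∀ j k, F j k = F k j)
    (hF0 : ∀ j k, 0 ≤ F j k) (hG : ∀ k d, 0 ≤ G k d)
    (hFG : ∀ k d, k + d < N → F (k + d) k ≤ G k d) :
    ∑ j ∈ Finset.range N, ∑ k ∈ Finset.range N, F j k ≤
      2 * ∑ k ∈ Finset.range N, ∑ d ∈ Finset.range N, G k d := by
  have h1 : ∀ k ∈ Finset.range N,
      ∑ j ∈ Finset.range N, (if k ≤ j then F j k else 0) ≤ ∑ d ∈ Finset.range N, G k d := by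
    intro k _
    rw [← Finset.sum_filter]
    have : (Finset.range N).filter (fun j => k ≤ j) = Finset.Ico k N := by
      ext j; simp; omega
    rw [this, Finset.sum_Ico_eq_sum_range]
    calc ∑ d ∈ Finset.range (N - k), F (k + d) k ≤ ∑ d ∈ Finset.range (N - k), G k d :=
          Finset.sum_le_sum fun d hd => hFG k d (by rw [Finset.mem_range] at hd; omega)
      _ ≤ _ := Finset.sum_le_sum_of_subset_of_nonneg
          (Finset.range_subset_range.2 (Nat.sub_le _ _)) fun d _ _ => hG k d
  have h2 := Finset.sum_le_sum h1
  have h3 : ∑ j ∈ Finset.range N, ∑ k ∈ Finset.range N, F j k ≤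
      ∑ j ∈ Finset.range N, ∑ k ∈ Finset.range N, (if k ≤ j then F j k else 0) +
      ∑ j ∈ Finset.range N, ∑ k ∈ Finset.range N, (if j ≤ k then F k j else 0) := by
    simp only [← Finset.sum_add_distrib]
    refine Finset.sum_le_sum fun j _ => Finset.sum_le_sum fun k _ => ?_
    rw [hF k j]
    have := hF0 j k
    split_ifs <;> linarith
  have h4 : ∑ j ∈ Finset.range N, ∑ k ∈ Finset.range N, (if k ≤ j then F j k else 0) =
      ∑ j ∈ Finset.range N, ∑ k ∈ Finset.range N, (if j ≤ k then F k j else 0) :=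
    Finset.sum_comm
  linarith

/-- After overlap-add, a Toeplitz covariance is close to a skew-circulant one in Frobenius
norm. -/
lemma frobSq_overlapAdd_sub_skewCirculant_le {g : ℤ → ℝ} (hg : ∀ d, g (-d) = g d) {p M : ℝ}
    (hp1 : 1 ≤ p) (hp2 : p ≤ 2) (hM : ∀ s : Finset ℕ, ∑ d ∈ s, (d : ℝ) ^ p * g d ^ 2 ≤ M)
    {m r n : ℕ} (hr : 0 < r) (hrm : r ≤ m) (hn : 2 * m + r = n) :
    frobSq (overlapAdd m r n * Matrix.of (fun i i' : Fin n => g ((i' : ℤ) - (i : ℤ))) *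
      (overlapAdd m r n).transpose - skewCirculant g m) ≤ 102 * (r : ℝ) ^ (1 - p) * M := by
  have hr0 : (0 : ℝ) < r := by exact_mod_cast hr
  have hm0 : (0 : ℝ) < m := by exact_mod_cast hr.trans_le hrm
  have hentry : ∀ j k : Fin (2 * m), (overlapAdd m r n * Matrix.of
      (fun i i' : Fin n => g ((i' : ℤ) - (i : ℤ))) *
      (overlapAdd m r n).transpose - skewCirculant g m) j k = overlapError g m r j k := by
    intro j k
    rw [Matrix.sub_apply, overlapAdd_mul_toeplitz_mul hr hn hg]
    rfl
  have h0 : frobSq (overlapAdd m r n * Matrix.of (fun i i' : Fin n => g ((i' : ℤ) - (i : ℤ))) *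
      (overlapAdd m r n).transpose - skewCirculant g m) =
      ∑ j ∈ Finset.range (2 * m), ∑ k ∈ Finset.range (2 * m), overlapError g m r j k ^ 2 := by
    simp only [frobSq, hentry]
    rw [← Fin.sum_univ_eq_sum_range
      (fun j => ∑ k ∈ Finset.range (2 * m), overlapError g m r j k ^ 2)]
    exact Finset.sum_congr rfl fun j _ =>
      Fin.sum_univ_eq_sum_range (fun k => overlapError g m r j k ^ 2) _
  rw [h0]
  have hw := overlapWeight_nonneg p r
  refine (sum_range_sum_range_le (fun j k => by rw [overlapError_comm hg])
    (fun _ _ => sq_nonneg _) (fun k d => ?_)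
    (fun k d hkd => overlapError_sq_le hg hp1 hp2 hr hrm hkd)).trans ?_
  · have h1 := hw k d
    have h2 := hw k (2 * m - d)
    have h3 := hw k (2 * m + d)
    positivity
  rw [Finset.sum_comm]
  set c : ℝ := (r : ℝ) ^ (1 - p) with hc
  have hc0 : 0 ≤ c := by positivity
  have hmc : (m : ℝ) ^ (1 - p) ≤ c :=
    Real.rpow_le_rpow_of_nonpos hr0 (by exact_mod_cast hrm) (by linarith)
  -- Summation over positions at a fixed lag. The `7` is `5` from the window plus `2` from the
  -- cutoff, since `2 * m * (d / m) ^ p ≤ 2 * c * d ^ p`. The final `102` is `2 * 3 * (7 + 5 + 5)`.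
  have hd : ∀ d ∈ Finset.range (2 * m), ∑ k ∈ Finset.range (2 * m),
      3 * ((overlapWeight p r k d + ((d : ℝ) / m) ^ p) * g d ^ 2
        + overlapWeight p r k (2 * m - d) * g (2 * m - d : ℕ) ^ 2
        + overlapWeight p r k (2 * m + d) * g (2 * m + d : ℕ) ^ 2) ≤
      3 * (7 * c * ((d : ℝ) ^ p * g d ^ 2)
        + 5 * c * (((2 * m - d : ℕ) : ℝ) ^ p * g (2 * m - d : ℕ) ^ 2)
        + 5 * c * (((2 * m + d : ℕ) : ℝ) ^ p * g (2 * m + d : ℕ) ^ 2)) := by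
    intro d _
    rw [← Finset.mul_sum, Finset.sum_add_distrib, Finset.sum_add_distrib, ← Finset.sum_mul,
      ← Finset.sum_mul, ← Finset.sum_mul, Finset.sum_add_distrib, Finset.sum_const,
      Finset.card_range, nsmul_eq_mul]
    have e : ((2 * m : ℕ) : ℝ) * ((d : ℝ) / m) ^ p ≤ 2 * c * (d : ℝ) ^ p := by
      rw [Real.div_rpow (by positivity) hm0.le]
      have : ((2 * m : ℕ) : ℝ) * ((d : ℝ) ^ p / (m : ℝ) ^ p) =
          2 * (m : ℝ) ^ (1 - p) * (d : ℝ) ^ p := by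
        rw [Real.rpow_sub hm0, Real.rpow_one]
        push_cast
        ring
      rw [this]
      gcongr
    have s1 := sum_overlapWeight_le hp1 hr (2 * m) d
    have s2 := sum_overlapWeight_le hp1 hr (2 * m) (2 * m - d)
    have s3 := sum_overlapWeight_le hp1 hr (2 * m) (2 * m + d)
    rw [← mul_assoc (7 * c), ← mul_assoc (5 * c), ← mul_assoc (5 * c)]
    gcongr
    linarith
  refine (mul_le_mul_of_nonneg_left (Finset.sum_le_sum hd) (by norm_num)).trans ?_
  rw [← Finset.mul_sum, Finset.sum_add_distrib, Finset.sum_add_distrib, ← Finset.mul_sum,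
    ← Finset.mul_sum, ← Finset.mul_sum]
  -- Each of the three families of lags is injective in `d`, so each weighted sum is at most `M`.
  set w : ℕ → ℝ := fun d => (d : ℝ) ^ p * g d ^ 2 with hw'
  have t1 : ∑ d ∈ Finset.range (2 * m), w d ≤ M := hM _
  have t2 : ∑ d ∈ Finset.range (2 * m), w (2 * m - d) ≤ M := by
    rw [← Finset.sum_image (f := w) (g := fun d => 2 * m - d)]
    · exact hM _
    · intro a ha b hb hab
      simp at ha hb hab
      omega
  have t3 : ∑ d ∈ Finset.range (2 * m), w (2 * m + d) ≤ M := by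
    rw [← Finset.sum_image (f := w) (g := fun d => 2 * m + d)]
    · exact hM _
    · intro a _ b _ hab
      simpa using hab
  have u1 := mul_le_mul_of_nonneg_left t1 hc0
  have u2 := mul_le_mul_of_nonneg_left t2 hc0
  have u3 := mul_le_mul_of_nonneg_left t3 hc0
  simp only [hw'] at u1 u2 u3
  nlinarith

/-! ### Parseval's identity on `[-π, π]` -/

lemma neg_pi_lt_pi : -π < π := by linarith [Real.pi_pos]

lemma fourierCoeffOn_pi (f : ℝ → ℂ) (k : ℤ) :
    fourierCoeffOn neg_pi_lt_pi f k =
      (2 * π : ℂ)⁻¹ * ∫ x in (-π)..π, Complex.exp (-(Complex.I * k * x)) * f x := by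
  rw [fourierCoeffOn_eq_integral, Complex.real_smul]
  congr 1
  · push_cast
    rw [one_div]
    congr 1
    ring
  · refine intervalIntegral.integral_congr fun x _ => ?_
    simp only [smul_eq_mul]
    rw [fourier_coe_apply]
    congr 2
    have hpi : (π : ℂ) ≠ 0 := by exact_mod_cast Real.pi_pos.ne'
    push_cast
    rw [sub_neg_eq_add]
    field_simp
    ring

lemma integral_exp_int_mul (n : ℤ) :
    ∫ x : ℝ in (-π)..π, Complex.exp (Complex.I * n * x) = if n = 0 then (2 * π : ℂ) else 0 := by
  split_ifs with hn
  · subst hn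
    simp
    ring
  · have hc : Complex.I * n ≠ 0 := mul_ne_zero Complex.I_ne_zero (by exact_mod_cast hn)
    rw [integral_exp_mul_complex hc]
    have h : Complex.exp (Complex.I * n * π) = Complex.exp (Complex.I * n * (-π : ℝ)) := by
      rw [Complex.exp_eq_exp_iff_exists_int]
      refine ⟨n, ?_⟩
      push_cast
      ring
    rw [h, sub_self, zero_div]

lemma fourierCoeffOn_trigPoly (s : Finset ℤ) (c : ℤ → ℂ) (k : ℤ) :
    fourierCoeffOn neg_pi_lt_pi (fun x => ∑ d ∈ s, c d * Complex.exp (Complex.I * d * x)) k =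
      if k ∈ s then c k else 0 := by
  rw [fourierCoeffOn_pi]
  have h1 : ∀ x : ℝ, Complex.exp (-(Complex.I * k * x)) *
      ∑ d ∈ s, c d * Complex.exp (Complex.I * d * x) =
      ∑ d ∈ s, c d * Complex.exp (Complex.I * (d - k : ℤ) * x) := by
    intro x
    rw [Finset.mul_sum]
    refine Finset.sum_congr rfl fun d _ => ?_
    rw [mul_left_comm, ← Complex.exp_add]
    congr 2
    push_cast
    ring
  simp only [h1]
  rw [intervalIntegral.integral_finsetSum fun d _ =>
    Continuous.intervalIntegrable (by fun_prop) _ _]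
  simp only [intervalIntegral.integral_const_mul, integral_exp_int_mul, sub_eq_zero]
  have hpi : (π : ℂ) ≠ 0 := by exact_mod_cast Real.pi_pos.ne'
  simp only [mul_ite, mul_zero, Finset.sum_ite_eq']
  split_ifs
  · field_simp
  · rfl

lemma hasSum_sq_fourierCoeffOn_pi {h : ℝ → ℝ} (hh : MemLp h 2 (volume.restrict (Ioc (-π) π))) :
    HasSum (fun k => 2 * π * ‖fourierCoeffOn neg_pi_lt_pi (fun x => (h x : ℂ)) k‖ ^ 2)
      (∫ x in (-π)..π, h x ^ 2) := by
  have h1 := (hasSum_sq_fourierCoeffOn neg_pi_lt_pi hh.ofReal).mul_left (2 * π)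
  have h2 : 2 * π * ((π - -π)⁻¹ • ∫ x in (-π)..π, ‖((h x : ℝ) : ℂ)‖ ^ 2) =
      ∫ x in (-π)..π, h x ^ 2 := by
    have : π - -π = 2 * π := by ring
    rw [this, smul_eq_mul, mul_inv_cancel_left₀ (by positivity)]
    simp
  rw [← h2]
  exact h1

/-! ### The truncated Fourier series -/

lemma sum_Ioo_eq_zero_of_odd {u : ℤ → ℂ} (hu : ∀ d, u (-d) = -u d) (m : ℕ) :
    ∑ d ∈ Finset.Ioo (-(m : ℤ)) m, u d = 0 := by
  have h : ∑ d ∈ Finset.Ioo (-(m : ℤ)) m, u (-d) = ∑ d ∈ Finset.Ioo (-(m : ℤ)) m, u d :=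
    Finset.sum_nbij' (fun d => -d) (fun d => -d) (by simp; omega) (by simp; omega)
      (by simp) (by simp) (by simp)
  simp only [hu, Finset.sum_neg_distrib] at h
  exact self_eq_neg.1 h.symm

/-- The derivative of `cosSum g m`. -/
def cosSumDeriv (g : ℤ → ℝ) (m : ℕ) (ω : ℝ) : ℝ :=
  ∑ d ∈ Finset.Ioo (-(m : ℤ)) m, g d * (-Real.sin (ω * d) * d)

lemma hasDerivAt_cosSum (g : ℤ → ℝ) (m : ℕ) (ω : ℝ) :
    HasDerivAt (cosSum g m) (cosSumDeriv g m ω) ω := by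
  unfold cosSum cosSumDeriv
  refine HasDerivAt.fun_sum fun d _ => HasDerivAt.const_mul _ ?_
  simpa using (hasDerivAt_mul_const (d : ℝ)).cos

lemma continuous_cosSum (g : ℤ → ℝ) (m : ℕ) : Continuous (cosSum g m) := by
  unfold cosSum; fun_prop

lemma continuous_cosSumDeriv (g : ℤ → ℝ) (m : ℕ) : Continuous (cosSumDeriv g m) := by
  unfold cosSumDeriv; fun_prop

lemma exp_I_mul_eq (d : ℤ) (x : ℝ) : Complex.exp (Complex.I * d * x) =
    (Real.cos (x * d) : ℂ) + Complex.I * (Real.sin (x * d) : ℂ) := by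
  rw [show Complex.I * d * x = ((x * d : ℝ) : ℂ) * Complex.I by push_cast; ring,
    Complex.exp_mul_I, Complex.ofReal_cos, Complex.ofReal_sin]
  ring

lemma ofReal_cosSum {g : ℤ → ℝ} (hg : ∀ d, g (-d) = g d) (m : ℕ) (x : ℝ) :
    (cosSum g m x : ℂ) =
      ∑ d ∈ Finset.Ioo (-(m : ℤ)) m, (g d : ℂ) * Complex.exp (Complex.I * d * x) := by
  simp only [exp_I_mul_eq, mul_add, Finset.sum_add_distrib]
  rw [sum_Ioo_eq_zero_of_odd
    (u := fun d : ℤ => (g d : ℂ) * (Complex.I * (Real.sin (x * d) : ℂ))) (fun d => ?_), add_zero,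
    cosSum]
  · push_cast; rfl
  · simp only [hg]
    push_cast
    rw [mul_neg, Complex.sin_neg]
    ring

lemma ofReal_cosSumDeriv {g : ℤ → ℝ} (hg : ∀ d, g (-d) = g d) (m : ℕ) (x : ℝ) :
    (cosSumDeriv g m x : ℂ) = ∑ d ∈ Finset.Ioo (-(m : ℤ)) m,
      (Complex.I * d * g d : ℂ) * Complex.exp (Complex.I * d * x) := by
  simp only [exp_I_mul_eq, mul_add, Finset.sum_add_distrib]
  rw [sum_Ioo_eq_zero_of_odd
    (u := fun d : ℤ => (Complex.I * d * g d : ℂ) * (Real.cos (x * d) : ℂ)) (fun d => ?_), zero_add,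
    cosSumDeriv]
  · push_cast
    refine Finset.sum_congr rfl fun d _ => ?_
    linear_combination (-(g d : ℂ) * d * Complex.sin (x * d)) * Complex.I_sq
  · simp only [hg]
    push_cast
    rw [mul_neg (x : ℂ), Complex.cos_neg]
    ring

lemma memLp_of_continuous {h : ℝ → ℝ} (hh : Continuous h) :
    MemLp h 2 (volume.restrict (Ioc (-π) π)) := by
  obtain ⟨C, hC⟩ := isCompact_Icc.exists_bound_of_continuousOn (hh.continuousOn (s := Icc (-π) π))
  refine MemLp.of_bound hh.aestronglyMeasurable C ?_
  filter_upwards [ae_restrict_mem measurableSet_Ioc] with x hx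
  exact hC x (Ioc_subset_Icc_self hx)

/-- Parseval with `k ^ 2 ≤ m ^ (2 - p) * |k| ^ p` for the retained lags; this is one place where `p
≤ 2` is needed. -/
lemma integral_cosSumDeriv_sq_le {g : ℤ → ℝ} (hg : ∀ d, g (-d) = g d) {p M : ℝ} (hp2 : p ≤ 2)
    (hp0 : 0 < p) (hsum : Summable fun k : ℤ => |(k : ℝ)| ^ p * g k ^ 2)
    (hM : ∑' k : ℤ, |(k : ℝ)| ^ p * g k ^ 2 ≤ M) {m : ℕ} (hm : 0 < m) :
    ∫ x in (-π)..π, cosSumDeriv g m x ^ 2 ≤ 2 * π * (m : ℝ) ^ (2 - p) * M := by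
  have h1 := hasSum_sq_fourierCoeffOn_pi (memLp_of_continuous (continuous_cosSumDeriv g m))
  simp only [ofReal_cosSumDeriv hg, fourierCoeffOn_trigPoly] at h1
  have h2 := hsum.hasSum.mul_left (2 * π * (m : ℝ) ^ (2 - p))
  refine (hasSum_le (fun k => ?_) h1 h2).trans (mul_le_mul_of_nonneg_left hM (by positivity))
  rw [mul_assoc (2 * π)]
  refine mul_le_mul_of_nonneg_left ?_ (by positivity)
  split_ifs with hk
  · rw [Finset.mem_Ioo] at hk
    simp only [norm_mul, Complex.norm_I, one_mul, Complex.norm_intCast, Complex.norm_real,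
      Real.norm_eq_abs, mul_pow, sq_abs]
    rw [← mul_assoc]
    refine mul_le_mul_of_nonneg_right ?_ (sq_nonneg _)
    rcases eq_or_ne k 0 with rfl | hk0
    · simp [hp0.ne']
    · have hkpos : (0 : ℝ) < |(k : ℝ)| := by simpa using hk0
      have hkm : |(k : ℝ)| ≤ m := by
        have : |k| ≤ m := abs_le.2 ⟨by omega, by omega⟩
        exact_mod_cast this
      rw [← sq_abs, ← Real.rpow_two]
      calc |(k : ℝ)| ^ (2 : ℝ) = |(k : ℝ)| ^ (2 - p) * |(k : ℝ)| ^ p := by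
            rw [← Real.rpow_add hkpos]; congr 1; ring
        _ ≤ _ := by gcongr
  · simp only [norm_zero, ne_eq, OfNat.ofNat_ne_zero, not_false_eq_true, zero_pow]
    positivity

/-- Only the lags `|k| ≥ m` remain, where `1 ≤ m ^ (-p) * |k| ^ p`. The series represents `2πf`
because `fourierCoef` carries no factor `1 / (2π)`. -/
lemma integral_cosSum_sub_sq_le {f : ℝ → ℝ} (hf : MemLp f 2 (volume.restrict (Icc (-π) π)))
    {g : ℤ → ℝ} (hg : ∀ d, g (-d) = g d) (hfg : ∀ k, (g k : ℂ) = fourierCoef f k) {p M : ℝ}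
    (hp0 : 0 < p) (hsum : Summable fun k : ℤ => |(k : ℝ)| ^ p * g k ^ 2)
    (hM : ∑' k : ℤ, |(k : ℝ)| ^ p * g k ^ 2 ≤ M) {m : ℕ} (hm : 0 < m) :
    ∫ x in (-π)..π, (cosSum g m x - 2 * π * f x) ^ 2 ≤ 2 * π * ((m : ℝ) ^ p)⁻¹ * M := by
  have hm0 : (0 : ℝ) < m := by exact_mod_cast hm
  have hf' : MemLp f 2 (volume.restrict (Ioc (-π) π)) :=
    hf.mono_measure (Measure.restrict_mono Ioc_subset_Icc_self le_rfl)
  have hfi : IntervalIntegrable f volume (-π) π := by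
    rw [intervalIntegrable_iff_integrableOn_Ioc_of_le neg_pi_lt_pi.le]
    exact hf'.integrable one_le_two
  have h1 := hasSum_sq_fourierCoeffOn_pi (h := fun x => cosSum g m x - 2 * π * f x)
    ((memLp_of_continuous (continuous_cosSum g m)).sub (hf'.const_mul (2 * π)))
  have hcoef : ∀ k : ℤ, fourierCoeffOn neg_pi_lt_pi
      (fun x => ((cosSum g m x - 2 * π * f x : ℝ) : ℂ)) k =
      (if k ∈ Finset.Ioo (-(m : ℤ)) m then (g k : ℂ) else 0) - g k := by
    intro k
    have hA := fourierCoeffOn_trigPoly (Finset.Ioo (-(m : ℤ)) m) (fun d => (g d : ℂ)) k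
    simp only [← ofReal_cosSum hg] at hA
    rw [fourierCoeffOn_pi] at hA
    -- The two Fourier conventions differ in the sign of the exponent; evenness of `g` reconciles
    -- them.
    rw [← hA, ← hg k, hfg (-k), fourierCoef, fourierCoeffOn_pi]
    have hpi : (π : ℂ) ≠ 0 := by exact_mod_cast Real.pi_pos.ne'
    have hfc : IntervalIntegrable (fun x : ℝ => Complex.exp (-(Complex.I * k * x)) * (f x : ℂ))
        volume (-π) π := by
      refine IntervalIntegrable.continuousOn_mul ?_ (by fun_prop)
      exact ⟨hfi.1.ofReal, hfi.2.ofReal⟩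
    have e : ∀ x : ℝ, Complex.exp (-(Complex.I * k * x)) *
        ((cosSum g m x - 2 * π * f x : ℝ) : ℂ) =
        Complex.exp (-(Complex.I * k * x)) * (cosSum g m x : ℂ) -
          2 * π * (Complex.exp (-(Complex.I * k * x)) * (f x : ℂ)) := by
      intro x
      push_cast
      ring
    simp only [e]
    rw [intervalIntegral.integral_sub, intervalIntegral.integral_const_mul, mul_sub,
      inv_mul_cancel_left₀ (by simp)]
    · congr 1
      refine intervalIntegral.integral_congr fun x _ => ?_
      congr 2
      push_cast
      ring
    · have := continuous_cosSum g m
      exact Continuous.intervalIntegrable (by fun_prop) _ _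
    · exact hfc.const_mul _
  simp only [hcoef] at h1
  have h2 := hsum.hasSum.mul_left (2 * π * ((m : ℝ) ^ p)⁻¹)
  refine (hasSum_le (fun k => ?_) h1 h2).trans (mul_le_mul_of_nonneg_left hM (by positivity))
  rw [mul_assoc (2 * π)]
  refine mul_le_mul_of_nonneg_left ?_ (by positivity)
  split_ifs with hk
  · simp only [sub_self, norm_zero, ne_eq, OfNat.ofNat_ne_zero, not_false_eq_true, zero_pow]
    positivity
  · rw [zero_sub, norm_neg, Complex.norm_real, Real.norm_eq_abs, sq_abs, ← mul_assoc]
    refine le_mul_of_one_le_left (sq_nonneg _) ?_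
    rw [inv_mul_eq_div, one_le_div (by positivity)]
    have hkm : (m : ℝ) ≤ |(k : ℝ)| := by
      have : (m : ℤ) ≤ |k| := by
        rw [Finset.mem_Ioo] at hk
        by_contra! h
        rw [abs_lt] at h
        omega
      exact_mod_cast this
    gcongr

/-! ### Cell averages -/

/-- Cauchy–Schwarz, by expanding the nonnegative integral of `((b - a) * h - I) ^ 2`. -/
lemma sq_integral_le {h : ℝ → ℝ} {a b : ℝ} (hab : a ≤ b)
    (h1 : IntervalIntegrable h volume a b)
    (h2 : IntervalIntegrable (fun x => h x ^ 2) volume a b) :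
    (∫ x in a..b, h x) ^ 2 ≤ (b - a) * ∫ x in a..b, h x ^ 2 := by
  rcases hab.eq_or_lt with rfl | hab'
  · simp
  set I := ∫ x in a..b, h x with hI
  have hpos : 0 < b - a := sub_pos.2 hab'
  have h0 : 0 ≤ ∫ x in a..b, ((b - a) * h x - I) ^ 2 :=
    intervalIntegral.integral_nonneg hab fun x _ => sq_nonneg _
  have e : ∀ x, ((b - a) * h x - I) ^ 2 =
      (b - a) ^ 2 * h x ^ 2 - 2 * (b - a) * I * h x + I ^ 2 := fun x => by ring
  simp only [e] at h0
  rw [intervalIntegral.integral_add ((h2.const_mul _).sub (h1.const_mul _)) (by simp),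
    intervalIntegral.integral_sub (h2.const_mul _) (h1.const_mul _),
    intervalIntegral.integral_const_mul, intervalIntegral.integral_const_mul, ← hI,
    intervalIntegral.integral_const, smul_eq_mul] at h0
  have h3 : 0 ≤ (b - a) * ((b - a) * (∫ x in a..b, h x ^ 2) - I ^ 2) := by
    nlinarith
  have := nonneg_of_mul_nonneg_right h3 hpos
  linarith

/-- The left end points of the cells of the grid of size `m` on `[-π, π]`. -/
def cellPoint (m j : ℕ) : ℝ := -π + 2 * π * j / m

lemma cellPoint_succ_sub (m j : ℕ) : cellPoint m (j + 1) - cellPoint m j = 2 * π / m := by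
  unfold cellPoint
  push_cast
  ring

lemma localAverage_eq {m : ℕ} (hm : 0 < m) (f : ℝ → ℝ) (j : Fin m) :
    2 * π * localAverage m f j = m * ∫ x in cellPoint m j..cellPoint m (j + 1), f x := by
  have hm0 : (m : ℝ) ≠ 0 := by positivity
  have hpi := Real.pi_pos
  rw [localAverage, intervalIntegral.integral_comp_mul_sub f (by positivity : 2 * π ≠ 0) π,
    smul_eq_mul]
  have e1 : 2 * π * ((j : ℝ) / m) - π = cellPoint m j := by unfold cellPoint; ring
  have e2 : 2 * π * (((j : ℝ) + 1) / m) - π = cellPoint m (j + 1) := by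
    unfold cellPoint; push_cast; ring
  rw [e1, e2]
  field_simp

lemma sum_integral_cell {m : ℕ} (hm : 0 < m) {h : ℝ → ℝ}
    (hh : IntervalIntegrable h volume (-π) π) :
    ∑ j : Fin m, ∫ x in cellPoint m j..cellPoint m (j + 1), h x = ∫ x in (-π)..π, h x := by
  have hm0 : (0 : ℝ) < m := by exact_mod_cast hm
  have h0 : cellPoint m 0 = -π := by simp [cellPoint]
  have hmm : cellPoint m m = π := by
    unfold cellPoint
    field_simp
    ring
  have hmono : Monotone (cellPoint m) := monotone_nat_of_le_succ fun j => by
    have := cellPoint_succ_sub m j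
    have : 0 < 2 * π / m := by positivity
    linarith
  rw [Fin.sum_univ_eq_sum_range
    (fun j => ∫ x in cellPoint m j..cellPoint m (j + 1), h x) m,
    intervalIntegral.sum_integral_adjacent_intervals, h0, hmm]
  intro k hk
  refine hh.mono_set ?_
  rw [uIcc_of_le (hmono (Nat.le_succ k)), uIcc_of_le neg_pi_lt_pi.le, ← h0, ← hmm]
  exact Icc_subset_Icc (hmono (Nat.zero_le _)) (hmono hk)

lemma sq_sub_le_of_hasDerivAt {F F' : ℝ → ℝ} (hF : ∀ x, HasDerivAt F (F' x) x)
    (hF' : Continuous F') {a b x y : ℝ} (hx : x ∈ Icc a b) (hy : y ∈ Icc a b) :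
    (F y - F x) ^ 2 ≤ (b - a) * ∫ t in a..b, F' t ^ 2 := by
  wlog hxy : x ≤ y generalizing x y
  · have := this hy hx (le_of_not_ge hxy)
    rwa [← neg_sub, neg_sq]
  have hc2 : Continuous fun t => F' t ^ 2 := hF'.pow 2
  have h1 : ∫ t in x..y, F' t = F y - F x :=
    intervalIntegral.integral_eq_sub_of_hasDerivAt (fun t _ => hF t) (hF'.intervalIntegrable _ _)
  have h2 : ∫ t in x..y, F' t ^ 2 ≤ ∫ t in a..b, F' t ^ 2 :=
    intervalIntegral.integral_mono_interval hx.1 hxy hy.2 (ae_of_all _ fun t => sq_nonneg _)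
      (hc2.intervalIntegrable _ _)
  have h3 : 0 ≤ ∫ t in x..y, F' t ^ 2 :=
    intervalIntegral.integral_nonneg hxy fun t _ => sq_nonneg _
  rw [← h1]
  refine (sq_integral_le hxy (hF'.intervalIntegrable _ _) (hc2.intervalIntegrable _ _)).trans ?_
  exact mul_le_mul (by linarith [hx.1, hy.2]) h2 h3 (by linarith [hx.1, hy.2])

/-- The squared difference of a point value of `F` and the average of `φ` over an interval. -/
lemma sq_sub_average_le {F F' φ : ℝ → ℝ} (hF : ∀ x, HasDerivAt F (F' x) x)
    (hF' : Continuous F') {a b x : ℝ} (hab : a < b) (hx : x ∈ Icc a b)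
    (hφ : IntervalIntegrable φ volume a b)
    (hφ2 : IntervalIntegrable (fun t => (F t - φ t) ^ 2) volume a b) :
    (F x - (b - a)⁻¹ * ∫ t in a..b, φ t) ^ 2 ≤
      2 * (b - a) * (∫ t in a..b, F' t ^ 2) + 2 * (b - a)⁻¹ * ∫ t in a..b, (F t - φ t) ^ 2 := by
  have hFc : Continuous F := continuous_iff_continuousAt.2 fun x => (hF x).continuousAt
  have hpos : 0 < b - a := sub_pos.2 hab
  -- The difference splits into the oscillation of `F`, controlled by its derivative, and the mean
  -- of `F - φ`.
  set u := ∫ t in a..b, (F x - F t) with hu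
  set w := ∫ t in a..b, (F t - φ t) with hw
  have hsplit : F x - (b - a)⁻¹ * ∫ t in a..b, φ t = (b - a)⁻¹ * u + (b - a)⁻¹ * w := by
    rw [hu, hw, intervalIntegral.integral_sub (by simp) (hFc.intervalIntegrable _ _),
      intervalIntegral.integral_sub (hFc.intervalIntegrable _ _) hφ,
      intervalIntegral.integral_const, smul_eq_mul]
    field_simp
    ring
  have hcx : Continuous fun t => F x - F t := by fun_prop
  have hu2 : u ^ 2 ≤ (b - a) ^ 3 * ∫ t in a..b, F' t ^ 2 := by
    refine (sq_integral_le hab.le (hcx.intervalIntegrable _ _)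
      ((hcx.pow 2).intervalIntegrable _ _)).trans ?_
    have : ∫ t in a..b, (F x - F t) ^ 2 ≤ ∫ _ in a..b, (b - a) * ∫ t in a..b, F' t ^ 2 :=
      intervalIntegral.integral_mono_on hab.le ((hcx.pow 2).intervalIntegrable _ _) (by simp)
        fun t ht => sq_sub_le_of_hasDerivAt hF hF' ht hx
    rw [intervalIntegral.integral_const, smul_eq_mul] at this
    calc _ ≤ (b - a) * ((b - a) * ((b - a) * ∫ t in a..b, F' t ^ 2)) :=
          mul_le_mul_of_nonneg_left this hpos.le
      _ = _ := by ring
  have hw2 : w ^ 2 ≤ (b - a) * ∫ t in a..b, (F t - φ t) ^ 2 :=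
    sq_integral_le hab.le ((hFc.intervalIntegrable _ _).sub hφ) hφ2
  have hi : 0 < (b - a)⁻¹ := inv_pos.2 hpos
  have h4 : ((b - a)⁻¹ * u + (b - a)⁻¹ * w) ^ 2 ≤
      2 * ((b - a)⁻¹ ^ 2 * u ^ 2) + 2 * ((b - a)⁻¹ ^ 2 * w ^ 2) := by
    nlinarith [sq_nonneg ((b - a)⁻¹ * u - (b - a)⁻¹ * w)]
  have h5 := mul_le_mul_of_nonneg_left hu2 (sq_nonneg (b - a)⁻¹)
  have h6 := mul_le_mul_of_nonneg_left hw2 (sq_nonneg (b - a)⁻¹)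
  have e5 : (b - a)⁻¹ ^ 2 * ((b - a) ^ 3 * ∫ t in a..b, F' t ^ 2) =
      (b - a) * ∫ t in a..b, F' t ^ 2 := by field_simp
  have e6 : (b - a)⁻¹ ^ 2 * ((b - a) * ∫ t in a..b, (F t - φ t) ^ 2) =
      (b - a)⁻¹ * ∫ t in a..b, (F t - φ t) ^ 2 := by field_simp
  rw [hsplit]
  rw [e5] at h5
  rw [e6] at h6
  linarith

/-- The two frequencies sit at one quarter and three quarters of the cell. -/
lemma hartleyFreq_mem_cell {m : ℕ} (hm : 0 < m) (j i : ℕ) (hi : i ≤ 1) :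
    hartleyFreq m (2 * j + i) ∈ Icc (cellPoint m j) (cellPoint m (j + 1)) := by
  have hm0 : (0 : ℝ) < m := by exact_mod_cast hm
  have hi' : (i : ℝ) ≤ 1 := by exact_mod_cast hi
  have hpos : 0 < π / m := by positivity
  have e : hartleyFreq m (2 * j + i) = cellPoint m j + π / m * ((i : ℝ) + 1 / 2) := by
    unfold hartleyFreq cellPoint
    push_cast
    field_simp
    ring
  have e2 := cellPoint_succ_sub m j
  have e3 : 2 * π / m = π / m * 2 := by ring
  have hi0 : (0 : ℝ) ≤ i := by positivity
  rw [e]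
  constructor
  · nlinarith
  · nlinarith

/-- The eigenvalues of the skew-circulant covariance are close to the local averages of the
spectral density. -/
lemma sum_sq_cosSum_sub_localAverage_le {f : ℝ → ℝ}
    (hf : MemLp f 2 (volume.restrict (Icc (-π) π))) {g : ℤ → ℝ} (hg : ∀ d, g (-d) = g d)
    (hfg : ∀ k, (g k : ℂ) = fourierCoef f k) {p M : ℝ} (hp0 : 0 < p) (hp2 : p ≤ 2)
    (hsum : Summable fun k : ℤ => |(k : ℝ)| ^ p * g k ^ 2)
    (hM : ∑' k : ℤ, |(k : ℝ)| ^ p * g k ^ 2 ≤ M) {m : ℕ} (hm : 0 < m) :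
    ∑ k, (cosSum g m (hartleyFreq m (hartleyLabel m k)) -
      2 * π * Sum.elim (localAverage m f) (localAverage m f) k) ^ 2 ≤
      260 * (m : ℝ) ^ (1 - p) * M := by
  have hm0 : (0 : ℝ) < m := by exact_mod_cast hm
  have hM0 : 0 ≤ M := le_trans (tsum_nonneg fun k => by positivity) hM
  have hf' : MemLp f 2 (volume.restrict (Ioc (-π) π)) :=
    hf.mono_measure (Measure.restrict_mono Ioc_subset_Icc_self le_rfl)
  have hφ : IntervalIntegrable (fun x => 2 * π * f x) volume (-π) π := by
    rw [intervalIntegrable_iff_integrableOn_Ioc_of_le neg_pi_lt_pi.le]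
    exact (hf'.integrable one_le_two).const_mul _
  have hφ2 : IntervalIntegrable (fun x => (cosSum g m x - 2 * π * f x) ^ 2) volume (-π) π := by
    rw [intervalIntegrable_iff_integrableOn_Ioc_of_le neg_pi_lt_pi.le]
    exact ((memLp_of_continuous (continuous_cosSum g m)).sub (hf'.const_mul (2 * π))).integrable_sq
  have hmono : Monotone (cellPoint m) := monotone_nat_of_le_succ fun j => by
    have := cellPoint_succ_sub m j
    have : 0 < 2 * π / m := by positivity
    linarith
  have hsub : ∀ j : Fin m, uIcc (cellPoint m j) (cellPoint m (j + 1)) ⊆ uIcc (-π) π := by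
    intro j
    have h0 : cellPoint m 0 = -π := by simp [cellPoint]
    have hmm : cellPoint m m = π := by
      unfold cellPoint
      field_simp
      ring
    rw [uIcc_of_le (hmono (Nat.le_succ _)), uIcc_of_le neg_pi_lt_pi.le, ← h0, ← hmm]
    exact Icc_subset_Icc (hmono (Nat.zero_le _)) (hmono j.2)
  set ℓ : ℝ := 2 * π / m with hℓ
  have hℓ0 : 0 < ℓ := by positivity
  set D : Fin m → ℝ := fun j => ∫ t in cellPoint m j..cellPoint m (j + 1), cosSumDeriv g m t ^ 2
  set R : Fin m → ℝ := fun j => ∫ t in cellPoint m j..cellPoint m (j + 1),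
    (cosSum g m t - 2 * π * f t) ^ 2
  have hcell : ∀ (j : Fin m) (i : ℕ), i ≤ 1 →
      (cosSum g m (hartleyFreq m (2 * j + i)) - 2 * π * localAverage m f j) ^ 2 ≤
        2 * ℓ * D j + 2 * ℓ⁻¹ * R j := by
    intro j i hi
    have hlt : cellPoint m j < cellPoint m (j + 1) := by
      have := cellPoint_succ_sub m j
      linarith
    have h := sq_sub_average_le (hasDerivAt_cosSum g m) (continuous_cosSumDeriv g m) hlt
      (hartleyFreq_mem_cell hm j i hi) (hφ.mono_set (hsub j)) (hφ2.mono_set (hsub j))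
    rw [cellPoint_succ_sub, intervalIntegral.integral_const_mul] at h
    have e : (2 * π / m)⁻¹ * (2 * π * ∫ t in cellPoint m j..cellPoint m (j + 1), f t) =
        2 * π * localAverage m f j := by
      rw [localAverage_eq hm]
      have := Real.pi_pos
      field_simp
    rwa [e] at h
  rw [Fintype.sum_sum_type]
  simp only [hartleyLabel, Sum.elim_inl, Sum.elim_inr]
  have hD : ∑ j, D j ≤ 2 * π * (m : ℝ) ^ (2 - p) * M := by
    refine (sum_integral_cell (h := fun t => cosSumDeriv g m t ^ 2) hm
      (((continuous_cosSumDeriv g m).pow 2).intervalIntegrable _ _)).trans_le ?_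
    exact integral_cosSumDeriv_sq_le hg hp2 hp0 hsum hM hm
  have hR : ∑ j, R j ≤ 2 * π * ((m : ℝ) ^ p)⁻¹ * M := by
    refine (sum_integral_cell hm hφ2).trans_le ?_
    exact integral_cosSum_sub_sq_le hf hg hfg hp0 hsum hM hm
  have hs : ∀ i, i ≤ 1 →
      ∑ j : Fin m, (cosSum g m (hartleyFreq m (2 * j + i)) - 2 * π * localAverage m f j) ^ 2 ≤
        2 * ℓ * (2 * π * (m : ℝ) ^ (2 - p) * M) + 2 * ℓ⁻¹ * (2 * π * ((m : ℝ) ^ p)⁻¹ * M) := by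
    intro i hi
    refine (Finset.sum_le_sum fun j _ => hcell j i hi).trans ?_
    rw [Finset.sum_add_distrib, ← Finset.mul_sum, ← Finset.mul_sum]
    gcongr
  have e1 : 2 * ℓ * (2 * π * (m : ℝ) ^ (2 - p) * M) = 8 * π ^ 2 * ((m : ℝ) ^ (1 - p) * M) := by
    have : (m : ℝ) ^ (2 - p) = m * (m : ℝ) ^ (1 - p) := by
      rw [show 2 - p = 1 + (1 - p) by ring, Real.rpow_add hm0, Real.rpow_one]
    rw [this, hℓ]
    field_simp
    ring
  have e2 : 2 * ℓ⁻¹ * (2 * π * ((m : ℝ) ^ p)⁻¹ * M) = 2 * ((m : ℝ) ^ (1 - p) * M) := by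
    rw [hℓ, Real.rpow_sub hm0, Real.rpow_one]
    have := Real.pi_pos
    field_simp
  have h0 := hs 0 zero_le_one
  have h1 := hs 1 le_rfl
  simp only [add_zero] at h0
  rw [e1, e2] at h0 h1
  -- Two frequencies per cell give `2 * (8 * π ^ 2 + 2) ≤ 260`.
  have hpi2 : π ^ 2 ≤ 16 := by
    have := Real.pi_le_four
    nlinarith [Real.pi_pos]
  have hmM : 0 ≤ (m : ℝ) ^ (1 - p) * M := by positivity
  nlinarith [mul_le_mul_of_nonneg_right hpi2 hmM]

/-! ### Autocovariances and the Toeplitz matrix -/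

lemma intervalIntegrable_of_memLp {f : ℝ → ℝ} (hf : MemLp f 2 (volume.restrict (Icc (-π) π))) :
    IntervalIntegrable f volume (-π) π := by
  rw [intervalIntegrable_iff_integrableOn_Ioc_of_le neg_pi_lt_pi.le]
  exact (hf.mono_measure (Measure.restrict_mono Ioc_subset_Icc_self le_rfl)).integrable one_le_two

lemma autocov_eq_integral {f : ℝ → ℝ} (hf : IntervalIntegrable f volume (-π) π) (k : ℤ) :
    autocov f k = ∫ x in (-π)..π, Real.cos (k * x) * f x := by
  have hi : IntervalIntegrable (fun x : ℝ => Complex.exp (Complex.I * k * x) * (f x : ℂ))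
      volume (-π) π :=
    IntervalIntegrable.continuousOn_mul ⟨hf.1.ofReal, hf.2.ofReal⟩ (by fun_prop)
  have h := Complex.reCLM.intervalIntegral_comp_comm hi
  rw [autocov, fourierCoef]
  refine h.symm.trans (intervalIntegral.integral_congr fun x _ => ?_)
  simp only [Complex.reCLM_apply, Complex.re_mul_ofReal]
  rw [show Complex.I * k * x = ((k * x : ℝ) : ℂ) * Complex.I by push_cast; ring,
    Complex.exp_ofReal_mul_I_re]

lemma autocov_neg {f : ℝ → ℝ} (hf : IntervalIntegrable f volume (-π) π) (k : ℤ) :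
    autocov f (-k) = autocov f k := by
  rw [autocov_eq_integral hf, autocov_eq_integral hf]
  push_cast
  simp only [neg_mul, Real.cos_neg]

/-- The quadratic form at `x` is the integral of `|∑ x_i exp(i·i'ω)|² f(ω)`, with `i'` the index of
the summand, written through its cosine and sine parts. -/
lemma toeplitzCov_posSemidef {f : ℝ → ℝ} (hf : IntervalIntegrable f volume (-π) π)
    (hf0 : ∀ x ∈ Icc (-π) π, 0 ≤ f x) (n : ℕ) : (toeplitzCov n f).PosSemidef := by
  refine Matrix.PosSemidef.of_dotProduct_mulVec_nonneg ?_ fun x => ?_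
  · ext i j
    simp only [toeplitzCov, Matrix.conjTranspose_apply, Matrix.of_apply, star_trivial]
    rw [← autocov_neg hf]
    congr 1
    ring
  · have hcos_int : ∀ i j : Fin n, IntervalIntegrable
        (fun ω => x i * (Real.cos ((((j : ℤ) - (i : ℤ) : ℤ) : ℝ) * ω) * f ω) * x j)
        volume (-π) π := fun i j =>
      ((hf.continuousOn_mul (by fun_prop)).const_mul _).mul_const _
    have h : star x ⬝ᵥ (toeplitzCov n f).mulVec x = ∫ ω in (-π)..π,
        ((∑ i : Fin n, x i * Real.cos ((i : ℕ) * ω)) ^ 2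
          + (∑ i : Fin n, x i * Real.sin ((i : ℕ) * ω)) ^ 2) * f ω := by
      simp only [dotProduct, Matrix.mulVec, star_trivial, toeplitzCov, Matrix.of_apply,
        autocov_eq_integral hf, Finset.mul_sum, ← intervalIntegral.integral_mul_const,
        ← intervalIntegral.integral_const_mul, ← mul_assoc]
      simp only [mul_assoc (x _) _ (f _)]
      rw [Finset.sum_congr rfl fun i _ =>
        (intervalIntegral.integral_finsetSum fun j _ => hcos_int i j).symm,
        ← intervalIntegral.integral_finsetSum fun i _ => ?_]
      · refine intervalIntegral.integral_congr fun ω _ => ?_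
        simp only [sq, Finset.sum_mul_sum]
        simp only [← Finset.sum_add_distrib, Finset.sum_mul]
        refine Finset.sum_congr rfl fun i _ => Finset.sum_congr rfl fun j _ => ?_
        push_cast
        rw [sub_mul, Real.cos_sub]
        ring
      · simpa only [Finset.sum_fn] using IntervalIntegrable.sum _ fun j _ => hcos_int i j
    rw [h]
    refine intervalIntegral.integral_nonneg neg_pi_lt_pi.le fun ω hω => ?_
    exact mul_nonneg (by positivity) (hf0 ω hω)

lemma le_localAverage {f : ℝ → ℝ} (hf : IntervalIntegrable f volume (-π) π) {c : ℝ}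
    (hc : ∀ x ∈ Icc (-π) π, c ≤ f x) {m : ℕ} (j : Fin m) : c ≤ localAverage m f j := by
  have hm : 0 < m := j.pos
  have hm0 : (0 : ℝ) < m := by exact_mod_cast hm
  have hpi := Real.pi_pos
  have hlen := cellPoint_succ_sub m j
  have hpos : 0 < 2 * π / m := by positivity
  have hle : cellPoint m j ≤ cellPoint m (j + 1) := by linarith
  have ha : -π ≤ cellPoint m j := by
    have : 0 ≤ 2 * π * (j : ℕ) / m := by positivity
    unfold cellPoint
    linarith
  have hb : cellPoint m (j + 1) ≤ π := by
    have h1 : ((j : ℕ) + 1 : ℝ) ≤ m := by exact_mod_cast j.2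
    have h2 : 2 * π * ((j : ℕ) + 1 : ℝ) / m ≤ 2 * π := by
      rw [div_le_iff₀ hm0]
      gcongr
    unfold cellPoint
    push_cast
    linarith
  have hsub : Icc (cellPoint m j) (cellPoint m (j + 1)) ⊆ Icc (-π) π := Icc_subset_Icc ha hb
  have hi : IntervalIntegrable f volume (cellPoint m j) (cellPoint m (j + 1)) := by
    refine hf.mono_set ?_
    rwa [uIcc_of_le hle, uIcc_of_le neg_pi_lt_pi.le]
  have h1 : ∫ _ in cellPoint m j..cellPoint m (j + 1), c ≤
      ∫ x in cellPoint m j..cellPoint m (j + 1), f x :=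
    intervalIntegral.integral_mono_on hle (by simp) hi fun x hx => hc x (hsub hx)
  rw [intervalIntegral.integral_const, hlen, smul_eq_mul] at h1
  have h2 := localAverage_eq hm f j
  have h3 : (m : ℝ) * (2 * π / m * c) = 2 * π * c := by field_simp
  have h4 := mul_le_mul_of_nonneg_left h1 hm0.le
  rw [h3, ← h2] at h4
  exact le_of_mul_le_mul_left h4 (by positivity)

/-! ### The product experiment -/

/-- Splitting a vector indexed by a sum type. -/
def splitSum (m : ℕ) (z : EuclideanSpace ℝ (Fin m ⊕ Fin m)) :
    EuclideanSpace ℝ (Fin m) × EuclideanSpace ℝ (Fin m) :=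
  (WithLp.toLp 2 fun j => z (.inl j), WithLp.toLp 2 fun j => z (.inr j))

lemma measurable_splitSum (m : ℕ) : Measurable (splitSum m) := by
  unfold splitSum
  fun_prop

lemma prod_multivariateGaussian_diagonal {m : ℕ} {d : Fin m → ℝ} (hd : ∀ j, 0 ≤ d j) :
    (multivariateGaussian 0 (Matrix.diagonal d)).prod (multivariateGaussian 0 (Matrix.diagonal d)) =
      (multivariateGaussian 0 (Matrix.diagonal (Sum.elim d d))).map (splitSum m) := by
  have hd' : ∀ k, 0 ≤ Sum.elim d d k := by rintro (j | j) <;> exact hd j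
  rw [multivariateGaussian_diagonal hd, multivariateGaussian_diagonal hd',
    Measure.map_map (measurable_splitSum m) (WithLp.measurable_toLp 2 _),
    Measure.map_prod_map _ _ (WithLp.measurable_toLp 2 _) (WithLp.measurable_toLp 2 _)]
  have h := (measurePreserving_sumPiEquivProdPi
    (fun k : Fin m ⊕ Fin m => gaussianReal 0 (Sum.elim d d k).toNNReal)).map_eq
  simp only [Sum.elim_inl, Sum.elim_inr] at h
  rw [← h, Measure.map_map (by fun_prop) (MeasurableEquiv.measurable _)]
  rfl

/-! ### The deficiency bound -/

/-- The transformation of the stationary sample: overlap-add followed by the Hartley transform. -/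
def reduction (m r n : ℕ) : Matrix (Fin m ⊕ Fin m) (Fin n) ℝ :=
  (√(2 * π))⁻¹ • (hartley m * overlapAdd m r n)

/-- The Hartley transform is orthogonal, so the overlap-add error passes through unchanged and the
eigenvalue error is added to it: `724 = 2 * 102 + 2 * 260`. The factor `(2π)⁻¹` squared is bounded
by `1`. -/
lemma frobSq_reduction_le {f : ℝ → ℝ} (hf : MemLp f 2 (volume.restrict (Icc (-π) π)))
    (hfg : ∀ k, (autocov f k : ℂ) = fourierCoef f k) {p M : ℝ} (hp1 : 1 ≤ p) (hp2 : p ≤ 2)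
    (hsum : Summable fun k : ℤ => |(k : ℝ)| ^ p * autocov f k ^ 2)
    (hM : ∑' k : ℤ, |(k : ℝ)| ^ p * autocov f k ^ 2 ≤ M) {m r n : ℕ} (hr : 0 < r) (hrm : r ≤ m)
    (hn : 2 * m + r = n) :
    frobSq (reduction m r n * toeplitzCov n f * (reduction m r n).transpose -
      Matrix.diagonal (Sum.elim (localAverage m f) (localAverage m f))) ≤
      724 * (r : ℝ) ^ (1 - p) * M := by
  have hm : 0 < m := hr.trans_le hrm
  have hM0 : 0 ≤ M := le_trans (tsum_nonneg fun k => by positivity) hM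
  have hg := autocov_neg (intervalIntegrable_of_memLp hf)
  set T := overlapAdd m r n
  set H := hartley m
  set Γ := toeplitzCov n f
  set C := skewCirculant (autocov f) m
  set J := Sum.elim (localAverage m f) (localAverage m f)
  set v : Fin m ⊕ Fin m → ℝ := fun k =>
    cosSum (autocov f) m (hartleyFreq m (hartleyLabel m k)) - 2 * π * J k with hv
  have hdiag : Matrix.diagonal v = H * C * H.transpose - (2 * π) • Matrix.diagonal J := by
    rw [hartley_mul_skewCirculant_mul hg hm, ← Matrix.diagonal_smul, Matrix.diagonal_sub]
    rfl
  have key : reduction m r n * Γ * (reduction m r n).transpose - Matrix.diagonal J =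
      (2 * π)⁻¹ • (H * (T * Γ * T.transpose - C) * H.transpose + Matrix.diagonal v) := by
    have hsq : (√(2 * π))⁻¹ * (√(2 * π))⁻¹ = (2 * π)⁻¹ := by
      rw [← mul_inv, Real.mul_self_sqrt (by positivity)]
    have e1 : reduction m r n * Γ * (reduction m r n).transpose =
        (2 * π)⁻¹ • (H * (T * Γ * T.transpose) * H.transpose) := by
      simp only [reduction, Matrix.transpose_smul, Matrix.smul_mul, Matrix.mul_smul, smul_smul,
        hsq, Matrix.transpose_mul, Matrix.mul_assoc]
      rfl
    rw [e1, hdiag, Matrix.mul_sub, Matrix.sub_mul, sub_add_sub_cancel, smul_sub, smul_smul,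
      inv_mul_cancel₀ (by positivity), one_smul]
  have hMfin : ∀ s : Finset ℕ, ∑ d ∈ s, (d : ℝ) ^ p * autocov f d ^ 2 ≤ M := by
    intro s
    refine le_trans ?_ hM
    have := hsum.sum_le_tsum (s.map Nat.castEmbedding) fun k _ => by positivity
    simpa using this
  have h1 : frobSq (T * Γ * T.transpose - C) ≤ 102 * (r : ℝ) ^ (1 - p) * M :=
    frobSq_overlapAdd_sub_skewCirculant_le hg hp1 hp2 hMfin hr hrm hn
  have h2 : ∑ k, v k ^ 2 ≤ 260 * (m : ℝ) ^ (1 - p) * M :=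
    sum_sq_cosSum_sub_localAverage_le hf hg hfg (by linarith) hp2 hsum hM hm
  have hmr : (m : ℝ) ^ (1 - p) ≤ (r : ℝ) ^ (1 - p) :=
    Real.rpow_le_rpow_of_nonpos (by exact_mod_cast hr) (by exact_mod_cast hrm) (by linarith)
  have h3 : 260 * (m : ℝ) ^ (1 - p) * M ≤ 260 * (r : ℝ) ^ (1 - p) * M := by gcongr
  rw [key, frobSq_smul]
  have h4 : ((2 * π)⁻¹) ^ 2 ≤ 1 :=
    pow_le_one₀ (by positivity) (inv_le_one_of_one_le₀ (by linarith [Real.pi_gt_three]))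
  refine (mul_le_of_le_one_left (frobSq_nonneg _) h4).trans ?_
  refine (frobSq_add_le _ _).trans ?_
  rw [frobSq_conj (hartley_transpose_mul_hartley hm), frobSq_diagonal]
  linarith

/-- Smoothness beyond `α = 1` is discarded, since the estimates need an exponent of at most `2`.
Lowering the exponent only decreases the weights: nonzero integers have `|k| ≥ 1`, and at `k = 0`
both weights vanish. -/
lemma spectralClass_autocov {α M : ℝ} (hα : 1 / 2 < α) {f : ℝ → ℝ} (hf : f ∈ spectralClass α M) :
    Summable (fun k : ℤ => |(k : ℝ)| ^ (2 * min α 1) * autocov f k ^ 2) ∧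
      ∑' k : ℤ, |(k : ℝ)| ^ (2 * min α 1) * autocov f k ^ 2 ≤ M := by
  obtain ⟨⟨-, hs, hle⟩, hb⟩ := hf
  have hfg := ofReal_autocov fun ω hω => (hb ω hω).2
  have hterm : ∀ k : ℤ, |(k : ℝ)| ^ (2 * min α 1) * autocov f k ^ 2 ≤
      |(k : ℝ)| ^ (2 * α) * ‖fourierCoef f k‖ ^ 2 := by
    intro k
    rw [← hfg, Complex.norm_real, Real.norm_eq_abs, sq_abs]
    refine mul_le_mul_of_nonneg_right ?_ (sq_nonneg _)
    have hmin : 0 < min α 1 := lt_min (by linarith) one_pos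
    rcases eq_or_ne k 0 with rfl | hk
    · rw [Int.cast_zero, abs_zero, Real.zero_rpow (by positivity), Real.zero_rpow (by linarith)]
    · have : (1 : ℝ) ≤ |(k : ℝ)| := by exact_mod_cast Int.one_le_abs hk
      exact Real.rpow_le_rpow_of_exponent_le this (by linarith [min_le_left α 1])
  have hsum := hs.of_nonneg_of_le (fun k => by positivity) hterm
  exact ⟨hsum, (hsum.tsum_le_tsum hterm hs).trans (by linarith [sq_nonneg ‖fourierCoef f 0‖])⟩

/-- The infimum is bounded by one deterministic kernel, `reduction` followed by `splitSum`, which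
does not depend on `f`. -/
lemma deficiency_le {α M : ℝ} (hα : 1 / 2 < α) (hM : 0 < M) {n : ℕ} (hn : Odd n)
    (hgap : gap n ≤ halfSize n)
    (hsmall : 724 * (gap n : ℝ) ^ (1 - 2 * min α 1) * M ≤ M⁻¹ ^ 2 / 4) :
    deficiency (spectralClass α M) (stationaryExperiment n) (lowerBracket n) ≤
      ENNReal.ofReal (√(2 * (724 * (gap n : ℝ) ^ (1 - 2 * min α 1) * M / M⁻¹ ^ 2))) := by
  set m := halfSize n with hm
  set r := gap n with hr
  have hr0 : 0 < r := by rw [hr, gap]; omega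
  set L := reduction m r n
  have hLm : Measurable fun y : EuclideanSpace ℝ (Fin n) =>
      WithLp.toLp 2 (L.mulVec y.ofLp) := by
    refine (WithLp.measurable_toLp 2 _).comp ?_
    exact (Continuous.matrix_mulVec continuous_const continuous_id).measurable.comp
      (WithLp.measurable_ofLp 2 _)
  have hκ := (measurable_splitSum m).comp hLm
  refine (iInf₂_le (Kernel.deterministic _ hκ)
    (Kernel.isMarkovKernel_deterministic hκ)).trans (iSup₂_le fun f hf => ?_)
  obtain ⟨hsum, hle⟩ := spectralClass_autocov hα hf
  have hfL := hf.1.1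
  have hfi := intervalIntegrable_of_memLp hfL
  have hlow : ∀ x ∈ Icc (-π) π, M⁻¹ ≤ f x := fun x hx => (hf.2 x hx).1
  have hMi : 0 < M⁻¹ := inv_pos.2 hM
  have hJ : ∀ j, M⁻¹ ≤ localAverage m f j := le_localAverage hfi hlow
  have hΓ := toeplitzCov_posSemidef hfi (fun x hx => hMi.le.trans (hlow x hx)) n
  have hfrob := frobSq_reduction_le hfL (ofReal_autocov fun ω hω => (hf.2 ω hω).2)
    (p := 2 * min α 1) (by have := lt_min hα (by norm_num : (1 / 2 : ℝ) < 1); linarith)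
    (by linarith [min_le_right α 1]) hsum hle hr0 hgap (two_mul_halfSize_add_gap hn)
  have hLΓ : (L * toeplitzCov n f * L.transpose).PosSemidef := by
    simpa using hΓ.mul_mul_conjTranspose_same L
  rw [Measure.deterministic_comp_eq_map, lowerBracket, prodExperiment, scaleExperiment,
    prod_multivariateGaussian_diagonal fun j => hMi.le.trans (hJ j), stationaryExperiment,
    ← Measure.map_map (measurable_splitSum m) hLm, map_multivariateGaussian hΓ]
  refine (tvDist_map_le _ _ (measurable_splitSum m)).trans ?_
  rw [tvDist_comm]
  refine (tvDist_multivariateGaussian_diagonal_le hLΓ hMi ?_ (hfrob.trans hsmall)).trans ?_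
  · rintro (j | j) <;> exact hJ j
  · apply ENNReal.ofReal_le_ofReal
    apply Real.sqrt_le_sqrt
    gcongr

/-! ### Growth of the gap -/

lemma tendsto_gap : Tendsto (fun n => (gap n : ℝ)) atTop atTop := by
  refine tendsto_atTop_mono (f := fun n : ℕ => Real.log n - 1) (fun n => ?_) ?_
  · have := Nat.lt_floor_add_one (Real.log n / 2)
    unfold gap
    push_cast
    linarith
  · exact tendsto_atTop_add_const_right _ _
      (Real.tendsto_log_atTop.comp tendsto_natCast_atTop_atTop)

lemma eventually_gap_le_halfSize : ∀ᶠ n in atTop ⊓ 𝓟 {n : ℕ | Odd n}, gap n ≤ halfSize n := by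
  have h1 : ∀ᶠ n : ℕ in atTop, 3 * Real.log n + 3 ≤ n := by
    -- With `1 / 6`, `3 * log n ≤ n / 2`, and `3 ≤ n / 2` once `n ≥ 6`. The resulting `3 * gap n ≤
    -- n` is equivalent to `gap n ≤ halfSize n`.
    have h := (Real.isLittleO_log_id_atTop.bound (by norm_num : (0 : ℝ) < 1 / 6))
    filter_upwards [tendsto_natCast_atTop_atTop.eventually h, eventually_ge_atTop 6] with n hn hn6
    have hl := Real.log_natCast_nonneg n
    have h6 : (6 : ℝ) ≤ n := by exact_mod_cast hn6
    simp only [Real.norm_eq_abs, id, abs_of_nonneg hl, Nat.abs_cast] at hn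
    linarith
  rw [eventually_inf_principal]
  filter_upwards [h1] with n hn hodd
  have h2 := two_mul_halfSize_add_gap hodd
  have h3 := Nat.floor_le (div_nonneg (Real.log_natCast_nonneg n) zero_le_two)
  have h4 : (gap n : ℝ) ≤ Real.log n + 1 := by
    unfold gap
    push_cast
    linarith
  have h5 : (3 * gap n : ℝ) ≤ n := by linarith
  have h6 : 3 * gap n ≤ n := by exact_mod_cast h5
  omega

end GaussTS

end

theorem mainTheorem4 (α M : ℝ) (hα : 1 / 2 < α) (hM : 0 < M) :
    GaussTS.AsympLessInformative (atTop ⊓ 𝓟 {n : ℕ | Odd n}) (GaussTS.spectralClass α M)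
      GaussTS.lowerBracket GaussTS.stationaryExperiment := by
  set p := 2 * min α 1 with hp
  -- The strict inequality `α > 1 / 2` enters here: it is what makes `gap n ^ (1 - p)` tend to zero.
  have hp1 : 0 < p - 1 := by
    have := lt_min hα (by norm_num : (1 / 2 : ℝ) < 1)
    linarith
  have h0 : Tendsto (fun n => (GaussTS.gap n : ℝ) ^ (1 - p)) (atTop ⊓ 𝓟 {n : ℕ | Odd n}) (𝓝 0) := by
    have := (tendsto_rpow_neg_atTop hp1).comp GaussTS.tendsto_gap
    simp only [neg_sub] at this
    exact this.mono_left inf_le_left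
  have h1 : Tendsto (fun n => 724 * (GaussTS.gap n : ℝ) ^ (1 - p) * M)
      (atTop ⊓ 𝓟 {n : ℕ | Odd n}) (𝓝 0) := by
    simpa using (h0.const_mul 724).mul_const M
  have h2 : Tendsto (fun n => ENNReal.ofReal
      (√(2 * (724 * (GaussTS.gap n : ℝ) ^ (1 - p) * M / M⁻¹ ^ 2))))
      (atTop ⊓ 𝓟 {n : ℕ | Odd n}) (𝓝 0) := by
    have h3 := (h1.div_const (M⁻¹ ^ 2)).const_mul 2
    have h4 := ENNReal.tendsto_ofReal h3.sqrt
    simpa using h4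
  have hpos : 0 < M⁻¹ ^ 2 / 4 := by positivity
  have hodd : ∀ᶠ n in atTop ⊓ 𝓟 {n : ℕ | Odd n}, Odd n :=
    mem_inf_of_right (mem_principal_self _)
  refine tendsto_of_tendsto_of_tendsto_of_le_of_le' tendsto_const_nhds h2
    (Eventually.of_forall fun n => zero_le) ?_
  filter_upwards [hodd, GaussTS.eventually_gap_le_halfSize, h1.eventually (ge_mem_nhds hpos)]
    with n hn hgap hsmall
  exact GaussTS.deficiency_le hα hM hn hgap hsmall
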